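/- Let $n\ge 1$. Let $\omega:\mathbb{R}^n\setminus\{o\}\to(0,\infty)$ be an even continuous function such that (A1) $\omega$ is locally integrable on $\mathbb{R}^n$; (A2) $\limsup_{|x|\to 0}|x|^n\omega(x)<\infty$; (A3) $\limsup_{|x|\to\infty}\frac{\ln\omega(x)}{|x|}\le 0$. Let $\mu$ be a nonzero even finite Borel measure on $\mathbb{R}^n$ which is not concentrated on any proper linear subspace of $\mathbb{R}^n$ and has finite first moment, $\int_{\mathbb{R}^n}|x|\,d\mu(x)<\infty$. Put $$|\mu|=\mu(\mathbb{R}^n),\qquad \zeta_\mu=\inf_{v\in S^{n-1}}\int_{\mathbb{R}^n}|\langle x,v\rangle|\,d\mu(x),\qquad \mathcal{F}_\omega(t)=\int_{\mathbb{R}^n}e^{-t|x|}\omega(x)\,dx\quad(t>0),$$ and suppose that $$\liminf_{t\to0^+}\Big(\mathcal{F}_\omega(t)\,e^{-\frac{\zeta_\mu}{2|\mu|t}}\Big)=0 .$$ Then there exists an upper semi-continuous log-concave function $f=e^{-\phi}:\mathbb{R}^n\to[0,\infty)$, with $\phi:\mathbb{R}^n\to\mathbb{R}\cup\{+\infty\}$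 convex and $0<\int_{\mathbb{R}^n}f\,dx<\infty$, such that $\mu=\widetilde{C}^e_\omega(f,\cdot)$, where $\widetilde{C}^e_\omega(f,\cdot)$ is the Euclidean dual $\omega$-Orlicz curvature measure of $f$, that is, $$\mu(E)=\widetilde{C}^e_\omega(f,E)=\int_{\{x\,:\,\nabla\phi(x)\in E\}}e^{-\phi(x)}\omega(x)\,dx\qquad\text{for every Borel set }E\subset\mathbb{R}^n$$ (the integration is over those points of the interior of $\{\phi<\infty\}$ at which $\phi$ is differentiable with $\nabla\phi(x)\in E$). -/

import Mathlib

open MeasureTheory Filter Topology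

noncomputable section

namespace OrliczMinkowski

/-- The class `𝒢` of weights on `ℝⁿ ∖ {0}`. A weight is a total function whose value at the
origin is unconstrained (and irrelevant for `n ≥ 1`, where `{0}` is Lebesgue-null). The two
upper limits are taken in the extended reals. -/
structure IsWeight {n : ℕ} (ω : EuclideanSpace ℝ (Fin n) → ℝ) : Prop where
  continuousOn : ContinuousOn ω {0}ᶜ
  pos : ∀ x, x ≠ 0 → 0 < ω x
  locallyIntegrable : LocallyIntegrable ω volume
  limsup_zero : limsup (fun x : EuclideanSpace ℝ (Fin n) => ((‖x‖ ^ n * ω x : ℝ) : EReal))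
    (𝓝[≠] 0) < ⊤
  limsup_infty : limsup (fun x : EuclideanSpace ℝ (Fin n) => ((Real.log (ω x) / ‖x‖ : ℝ) : EReal))
    (Bornology.cobounded (EuclideanSpace ℝ (Fin n))) ≤ 0

/-- The class `LC_n` of upper semicontinuous log-concave functions `f : ℝⁿ → [0, ∞)` with
nonzero finite `L¹` norm. -/
structure IsLC {n : ℕ} (f : EuclideanSpace ℝ (Fin n) → ℝ) : Prop where
  nonneg : ∀ x, 0 ≤ f x
  logConcave : ∀ x y : EuclideanSpace ℝ (Fin n), ∀ a b : ℝ, 0 < a → 0 < b → a + b = 1 →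
    f x ^ a * f y ^ b ≤ f (a • x + b • y)
  upperSemicontinuous : UpperSemicontinuous f
  integrable : Integrable f volume
  integral_pos : 0 < ∫ x, f x

/-- The Orlicz moment `∫ f ω dx` of a nonnegative function `f`, as an element of `[0, ∞]`. -/
def orliczMoment {n : ℕ} (ω f : EuclideanSpace ℝ (Fin n) → ℝ) : ENNReal :=
  ∫⁻ x, ENNReal.ofReal (f x * ω x)

/-- `𝓕_ω(t) = ∫ e^{-t|x|} ω(x) dx`. -/
def orliczF {n : ℕ} (ω : EuclideanSpace ℝ (Fin n) → ℝ) (t : ℝ) : ENNReal :=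
  orliczMoment ω (fun x => Real.exp (-(t * ‖x‖)))

/-- `ζ_μ`, the infimum over unit vectors `v` of `∫ |⟨x, v⟩| dμ(x)`. -/
def zeta {n : ℕ} (μ : Measure (EuclideanSpace ℝ (Fin n))) : ℝ :=
  ⨅ v : Metric.sphere (0 : EuclideanSpace ℝ (Fin n)) 1, ∫ x, |inner ℝ x (v : EuclideanSpace ℝ (Fin n))| ∂μ

/-- The potential `φ` of `f = e^{-φ}`. It is used only where `f > 0`, where it is finite. -/
def potential {n : ℕ} (f : EuclideanSpace ℝ (Fin n) → ℝ) (x : EuclideanSpace ℝ (Fin n)) : ℝ :=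
  -Real.log (f x)

/-- The points at which `∇φ` exists, `f = e^{-φ}`: the point is interior to
`dom φ = {f > 0}`, and `φ` is differentiable there. -/
def gradDomain {n : ℕ} (f : EuclideanSpace ℝ (Fin n) → ℝ) : Set (EuclideanSpace ℝ (Fin n)) :=
  {x | x ∈ interior {y | 0 < f y} ∧ DifferentiableAt ℝ (potential f) x}

/-- The Euclidean dual Orlicz curvature measure of `f = e^{-φ}`: the push-forward under `∇φ` of
the measure `e^{-φ(x)} ω(x) dx`. -/
def curvatureMeasure {n : ℕ} (ω f : EuclideanSpace ℝ (Fin n) → ℝ) :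
    Measure (EuclideanSpace ℝ (Fin n)) :=
  ((volume.withDensity (fun x => ENNReal.ofReal (f x * ω x))).restrict (gradDomain f)).map
    (gradient (potential f))

theorem measurable_gradient_potential {n : ℕ} (f : EuclideanSpace ℝ (Fin n) → ℝ) :
    Measurable (gradient (potential f)) :=
  (LinearIsometryEquiv.continuous _).measurable.comp (measurable_fderiv ℝ (potential f))

theorem measurableSet_gradDomain {n : ℕ} (f : EuclideanSpace ℝ (Fin n) → ℝ) :
    MeasurableSet (gradDomain f) :=
  isOpen_interior.measurableSet.inter (measurableSet_of_differentiableAt ℝ (potential f))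

/-- The defining formula: the curvature measure of a Borel set `B` is the integral of
`e^{-φ} ω` over the points `x` at which `∇φ(x)` exists and belongs to `B`. -/
theorem curvatureMeasure_apply {n : ℕ} (ω f : EuclideanSpace ℝ (Fin n) → ℝ)
    {B : Set (EuclideanSpace ℝ (Fin n))} (hB : MeasurableSet B) :
    curvatureMeasure ω f B =
      ∫⁻ x in {x | x ∈ gradDomain f ∧ gradient (potential f) x ∈ B},
        ENNReal.ofReal (f x * ω x) := by
  have hg := measurable_gradient_potential f
  have hd := measurableSet_gradDomain f
  have hset : {x | x ∈ gradDomain f ∧ gradient (potential f) x ∈ B} =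
      gradient (potential f) ⁻¹' B ∩ gradDomain f := by
    ext x
    exact and_comm
  rw [curvatureMeasure, Measure.map_apply hg hB, Measure.restrict_apply (hg hB), hset,
    withDensity_apply _ ((hg hB).inter hd)]

end OrliczMinkowski

end

open scoped ENNReal RealInnerProductSpace

namespace OrliczMinkowski

/-! ### The function `a ↦ e⁻ᵃ` on `[0, ∞]` -/

/-! Variational proof. Write W = ω dx, let φ be the polar of a potential ψ ≥ 0 for the even cost
|⟨x,y⟩|, and let m(ψ) be the mean of ψ with respect to μ. The functional maximised is ∫ e^{-φ} dW ·
e^{-m(ψ)}. If a maximiser exists, its Euler-Lagrange equation says that the push-forward of e^{-φ}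
dW under ∇φ is proportional to μ. Multiplying e^{-φ} by a constant then corrects the mass without
changing gradients.

Coercivity. As μ is not carried by a hyperplane, some a > 0 satisfies a‖x‖·|μ| ≤ ∫ |⟨x,y⟩| dμ(y) for
all x. Integrating |⟨x,y⟩| ≤ φ(x) + ψ(y) in y gives φ(x) + m(ψ) ≥ a‖x‖ for every ψ
(`ofReal_mul_norm_le_polar_add`). So e^{-φ-m(ψ)} is at most e^{-a‖x‖}, which is W-integrable, and
also at most e^{-m(ψ)}: the supremum is finite and m(ψ) stays bounded along maximising sequences.

Compactness. A lower bound on ∫ e^{-φ} dW forces a uniform upper bound for φ on a ball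
(`exists_polar_le_on_ball`). Convexity and a diagonal argument then give an almost everywhere
convergent subsequence of the φ's (`exists_subseq_limsup_polar_le_liminf`). The polar of the limit
is a maximiser, by Fatou and dominated convergence (`exists_maximizer`).

Euler-Lagrange. Replacing ψ by ψ + t g with g ≥ 0 bounded, continuous and even, and letting t → 0⁺,
Fatou gives a one-sided inequality between integrals of g (`setLIntegral_gradient_le`). Both sides
have the same total mass, so applying the inequality to B - g as well turns it into an equality
(`gradientMeasure_eq_smul`). -/

/-- The decreasing exponential `e⁻ᵃ` for `a ∈ [0, ∞]`. -/
noncomputable def nexp (a : ℝ≥0∞) : ℝ≥0∞ := EReal.exp (-(a : EReal))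

@[simp] theorem nexp_top : nexp ∞ = 0 := by simp [nexp]

@[simp] theorem nexp_zero : nexp 0 = 1 := by simp [nexp]

theorem nexp_antitone : Antitone nexp := fun a b h => by
  simp only [nexp, EReal.exp_le_exp_iff, EReal.neg_le_neg_iff]
  exact_mod_cast h

theorem nexp_le_one (a : ℝ≥0∞) : nexp a ≤ 1 := by
  simpa using nexp_antitone (zero_le : 0 ≤ a)

theorem nexp_ne_top (a : ℝ≥0∞) : nexp a ≠ ∞ := ((nexp_le_one a).trans_lt ENNReal.one_lt_top).ne

theorem nexp_eq_zero_iff {a : ℝ≥0∞} : nexp a = 0 ↔ a = ∞ := by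
  simp [nexp, EReal.neg_eq_bot_iff]

theorem nexp_add (a b : ℝ≥0∞) : nexp (a + b) = nexp a * nexp b := by
  rw [nexp, nexp, nexp, ← EReal.exp_add, EReal.coe_ennreal_add, EReal.neg_add] <;> simp [sub_eq_add_neg]

theorem continuous_nexp : Continuous nexp :=
  ENNReal.continuous_exp.comp (continuous_neg.comp continuous_coe_ennreal_ereal)

theorem measurable_nexp : Measurable nexp := continuous_nexp.measurable

theorem nexp_ofReal {r : ℝ} (hr : 0 ≤ r) :
    nexp (ENNReal.ofReal r) = ENNReal.ofReal (Real.exp (-r)) := by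
  rw [nexp, EReal.coe_ennreal_ofReal, max_eq_left hr, ← EReal.coe_neg, EReal.exp_coe]

theorem nexp_of_ne_top {a : ℝ≥0∞} (ha : a ≠ ∞) :
    nexp a = ENNReal.ofReal (Real.exp (-a.toReal)) := by
  rw [← nexp_ofReal ENNReal.toReal_nonneg, ENNReal.ofReal_toReal ha]

theorem toReal_nexp_of_ne_top {a : ℝ≥0∞} (ha : a ≠ ∞) :
    (nexp a).toReal = Real.exp (-a.toReal) := by
  rw [nexp_of_ne_top ha, ENNReal.toReal_ofReal (Real.exp_pos _).le]

theorem neg_log_toReal_nexp (a : ℝ≥0∞) : -Real.log (nexp a).toReal = a.toReal := by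
  by_cases ha : a = ∞
  · simp [ha]
  · rw [toReal_nexp_of_ne_top ha, Real.log_exp, neg_neg]

theorem toReal_nexp_pos_iff {a : ℝ≥0∞} : 0 < (nexp a).toReal ↔ a ≠ ∞ := by
  rw [ENNReal.toReal_pos_iff, pos_iff_ne_zero, Ne, nexp_eq_zero_iff]
  exact ⟨fun h => h.1, fun h => ⟨h, (nexp_ne_top a).lt_top⟩⟩

/-! ### Polarity of even potentials -/

variable {E : Type*} [NormedAddCommGroup E] [InnerProductSpace ℝ E]

/-- The Legendre transform with respect to the even cost `|⟪x, y⟫|`, truncated at `0`. -/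
noncomputable def polar (ψ : E → ℝ≥0∞) (x : E) : ℝ≥0∞ :=
  ⨆ y, (ENNReal.ofReal |⟪x, y⟫| - ψ y)

theorem polar_le_iff {ψ : E → ℝ≥0∞} {x : E} {c : ℝ≥0∞} :
    polar ψ x ≤ c ↔ ∀ y, ENNReal.ofReal |⟪x, y⟫| ≤ c + ψ y := by
  simp [polar, iSup_le_iff, tsub_le_iff_right]

theorem le_polar_add (ψ : E → ℝ≥0∞) (x y : E) :
    ENNReal.ofReal |⟪x, y⟫| ≤ polar ψ x + ψ y :=
  polar_le_iff.1 le_rfl y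

theorem polar_polar_le (ψ : E → ℝ≥0∞) (y : E) : polar (polar ψ) y ≤ ψ y :=
  polar_le_iff.2 fun x => by
    rw [real_inner_comm, add_comm]
    exact le_polar_add ψ x y

theorem polar_neg (ψ : E → ℝ≥0∞) (x : E) : polar ψ (-x) = polar ψ x := by
  simp [polar]

theorem polar_zero (ψ : E → ℝ≥0∞) : polar ψ 0 = 0 := by
  simp [polar]

/-- Convexity, as for any supremum of convex functions of x. Working in [0, ∞] needs no finiteness
assumption: the two weighted copies of ψ z add up to ψ z. -/
theorem polar_smul_add_smul_le (ψ : E → ℝ≥0∞) {a b : ℝ} (ha : 0 ≤ a) (hb : 0 ≤ b)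
    (hab : a + b = 1) (x y : E) :
    polar ψ (a • x + b • y) ≤ ENNReal.ofReal a * polar ψ x + ENNReal.ofReal b * polar ψ y := by
  refine polar_le_iff.2 fun z => ?_
  have h1 : |⟪a • x + b • y, z⟫| ≤ a * |⟪x, z⟫| + b * |⟪y, z⟫| := by
    rw [inner_add_left, real_inner_smul_left, real_inner_smul_left]
    refine (abs_add_le _ _).trans_eq ?_
    rw [abs_mul, abs_mul, abs_of_nonneg ha, abs_of_nonneg hb]
  have h2 : ENNReal.ofReal a + ENNReal.ofReal b = 1 := by
    rw [← ENNReal.ofReal_add ha hb, hab, ENNReal.ofReal_one]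
  calc ENNReal.ofReal |⟪a • x + b • y, z⟫|
      ≤ ENNReal.ofReal a * ENNReal.ofReal |⟪x, z⟫| + ENNReal.ofReal b * ENNReal.ofReal |⟪y, z⟫| := by
        rw [← ENNReal.ofReal_mul ha, ← ENNReal.ofReal_mul hb,
          ← ENNReal.ofReal_add (by positivity) (by positivity)]
        exact ENNReal.ofReal_le_ofReal h1
    _ ≤ ENNReal.ofReal a * (polar ψ x + ψ z) + ENNReal.ofReal b * (polar ψ y + ψ z) := by
        gcongr <;> exact le_polar_add _ _ _
    _ = ENNReal.ofReal a * polar ψ x + ENNReal.ofReal b * polar ψ y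
          + (ENNReal.ofReal a + ENNReal.ofReal b) * ψ z := by ring
    _ = _ := by rw [h2, one_mul]

/-- A convex function that is nonnegative and vanishes at the origin is nondecreasing along rays. -/
theorem polar_smul_le (ψ : E → ℝ≥0∞) {a : ℝ} (ha : 0 ≤ a) (ha' : a ≤ 1) (x : E) :
    polar ψ (a • x) ≤ polar ψ x := by
  have := polar_smul_add_smul_le ψ ha (sub_nonneg.2 ha') (by ring) x 0
  rw [smul_zero, add_zero, polar_zero, mul_zero, add_zero] at this
  exact this.trans (mul_le_of_le_one_left' (by simpa using ha'))

/-- The point z is a convex combination, with weights a and 1 - a, of x and a point of the ball of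
radius r. This compares values at nearby points at the price of a dilation and an error that
vanishes as a → 1, even where the polar may be infinite. -/
theorem polar_le_of_mem_ball {ψ : E → ℝ≥0∞} {r : ℝ} {C : ℝ≥0∞}
    (hC : ∀ x, ‖x‖ < r → polar ψ x ≤ C) {a : ℝ} (ha : 0 < a) (ha' : a < 1) {x z : E}
    (hz : ‖z - a • x‖ < (1 - a) * r) :
    polar ψ z ≤ polar ψ x + ENNReal.ofReal (1 - a) * C := by
  have h1 : 0 < 1 - a := sub_pos.2 ha'
  have hz' : z = a • x + (1 - a) • ((1 - a)⁻¹ • (z - a • x)) := by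
    rw [smul_inv_smul₀ h1.ne']
    abel
  conv_lhs => rw [hz']
  refine (polar_smul_add_smul_le ψ ha.le h1.le (by ring) _ _).trans ?_
  gcongr
  · exact mul_le_of_le_one_left' (by simpa using ha'.le)
  · apply hC
    rwa [norm_smul, norm_inv, Real.norm_of_nonneg h1.le, inv_mul_lt_iff₀ h1]

theorem lowerSemicontinuous_polar (ψ : E → ℝ≥0∞) : LowerSemicontinuous (polar ψ) := by
  refine lowerSemicontinuous_iSup fun y => Continuous.lowerSemicontinuous ?_
  exact (ENNReal.continuous_sub_right _).comp (ENNReal.continuous_ofReal.comp (by fun_prop))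

theorem measurable_polar [MeasurableSpace E] [BorelSpace E] (ψ : E → ℝ≥0∞) :
    Measurable (polar ψ) :=
  (lowerSemicontinuous_polar ψ).measurable

theorem convex_polar_ne_top (ψ : E → ℝ≥0∞) : Convex ℝ {x | polar ψ x ≠ ∞} := by
  intro x hx y hy a b ha hb hab
  refine ne_top_of_le_ne_top ?_ (polar_smul_add_smul_le ψ ha hb hab x y)
  exact ENNReal.add_ne_top.2 ⟨ENNReal.mul_ne_top ENNReal.ofReal_ne_top hx,
    ENNReal.mul_ne_top ENNReal.ofReal_ne_top hy⟩

theorem convexOn_toReal_polar (ψ : E → ℝ≥0∞) :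
    ConvexOn ℝ {x | polar ψ x ≠ ∞} (fun x => (polar ψ x).toReal) := by
  refine ⟨convex_polar_ne_top ψ, fun x hx y hy a b ha hb hab => ?_⟩
  have hx' := ENNReal.mul_ne_top (ENNReal.ofReal_ne_top (r := a)) hx
  have hy' := ENNReal.mul_ne_top (ENNReal.ofReal_ne_top (r := b)) hy
  have h := ENNReal.toReal_mono (ENNReal.add_ne_top.2 ⟨hx', hy'⟩)
    (polar_smul_add_smul_le ψ ha hb hab x y)
  rwa [ENNReal.toReal_add hx' hy', ENNReal.toReal_mul, ENNReal.toReal_mul,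
    ENNReal.toReal_ofReal ha, ENNReal.toReal_ofReal hb] at h

/-- Integrating the polarity inequality bounds the polar from below by the first moment. -/
theorem lintegral_inner_le [MeasurableSpace E] [BorelSpace E] {μ : Measure E}
    {ψ : E → ℝ≥0∞} (x : E) :
    ∫⁻ y, ENNReal.ofReal |⟪x, y⟫| ∂μ ≤ polar ψ x * μ Set.univ + ∫⁻ y, ψ y ∂μ := by
  calc ∫⁻ y, ENNReal.ofReal |⟪x, y⟫| ∂μ ≤ ∫⁻ y, (polar ψ x + ψ y) ∂μ :=
        lintegral_mono fun y => le_polar_add ψ x y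
    _ = _ := by rw [lintegral_add_left measurable_const, lintegral_const]

end OrliczMinkowski

namespace OrliczMinkowski

variable {E : Type*} [NormedAddCommGroup E] [InnerProductSpace ℝ E] [FiniteDimensional ℝ E]
  [MeasurableSpace E] [BorelSpace E]

/-! ### Null sets and thin slabs -/

open scoped Pointwise in
/-- A measurable set meeting each ray from the origin at most once is null. -/
theorem addHaar_eq_zero_of_smul_notMem (vol : Measure E) [vol.IsAddHaarMeasure] {B : Set E}
    (hB : MeasurableSet B) (h : ∀ x ∈ B, ∀ a : ℝ, 0 < a → a < 1 → a • x ∉ B) : vol B = 0 := by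
  have hunion : B = ⋃ R : ℕ, B ∩ Metric.ball 0 R := by
    rw [← Set.inter_iUnion, Metric.iUnion_ball_nat, Set.inter_univ]
  rw [hunion, measure_iUnion_null_iff]
  intro R
  set A := B ∩ Metric.ball (0 : E) R with hA
  have hAm : MeasurableSet A := hB.inter measurableSet_ball
  -- The dilates c k • A with distinct c k in [1/2, 1) are pairwise disjoint, lie in one ball, and
  -- each has volume at least 2^{-dim} times that of A. Infinitely many of them fit only if A is
  -- null.
  set c : ℕ → ℝ := fun k => 1 / 2 + 1 / ((k : ℝ) + 3) with hc
  have hc0 : ∀ k, 1 / 2 ≤ c k := fun k => by simp only [hc]; linarith [show 0 < 1 / ((k : ℝ) + 3) by positivity]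
  have hc1 : ∀ k, c k < 1 := fun k => by
    simp only [hc]
    have : 1 / ((k : ℝ) + 3) < 1 / 2 := one_div_lt_one_div_of_lt (by norm_num) (by linarith [k.cast_nonneg (α := ℝ)])
    linarith
  have hpos : ∀ k, 0 < c k := fun k => by linarith [hc0 k]
  have hanti : StrictAnti c := fun i j hij => by
    simp only [hc]
    have : (i : ℝ) < j := by exact_mod_cast hij
    gcongr
  have hdisj' : ∀ i j, c i < c j → Disjoint (c i • A) (c j • A) := by
    intro i j hij
    rw [Set.disjoint_left]
    rintro _ ⟨x, hx, rfl⟩ ⟨y, hy, hxy⟩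
    refine h x hx.1 (c i / c j) (div_pos (hpos i) (hpos j)) ((div_lt_one (hpos j)).2 hij) ?_
    have : (c i / c j) • x = y := by
      have hxy' : c j • y = c i • x := hxy
      rw [div_eq_inv_mul, mul_smul, ← hxy', inv_smul_smul₀ (hpos j).ne']
    rw [this]
    exact hy.1
  have hdisj : Pairwise (Function.onFun Disjoint fun k => c k • A) := by
    intro i j hij
    rcases lt_or_gt_of_ne (hanti.injective.ne hij) with h1 | h1
    · exact hdisj' i j h1
    · exact (hdisj' j i h1).symm
  by_contra hne
  have hsub : ⋃ k, c k • A ⊆ Metric.ball (0 : E) R := by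
    refine Set.iUnion_subset fun k => ?_
    rintro _ ⟨x, hx, rfl⟩
    have hx' : ‖x‖ < R := by simpa using hx.2
    simp only [mem_ball_zero_iff, norm_smul, Real.norm_eq_abs, abs_of_pos (hpos k)]
    nlinarith [norm_nonneg x, hc1 k]
  have hle : ∑' _ : ℕ, ENNReal.ofReal ((1 / 2) ^ Module.finrank ℝ E) * vol A ≤
      vol (Metric.ball (0 : E) R) := by
    calc _ ≤ ∑' k, vol (c k • A) := by
          refine ENNReal.tsum_le_tsum fun k => ?_
          rw [Measure.addHaar_smul_of_nonneg _ (hpos k).le]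
          gcongr
          exact hc0 k
      _ = vol (⋃ k, c k • A) :=
          (measure_iUnion hdisj fun k => hAm.const_smul_of_ne_zero (hpos k).ne').symm
      _ ≤ _ := measure_mono hsub
  rw [ENNReal.tsum_const_eq_top_of_ne_zero] at hle
  · exact absurd hle (not_le.2 measure_ball_lt_top)
  · refine mul_ne_zero ?_ hne
    simp

theorem addHaar_inner_eq_zero (vol : Measure E) [vol.IsAddHaarMeasure] {v : E} (hv : v ≠ 0) :
    vol {x | ⟪x, v⟫ = 0} = 0 := by
  have hset : {x | ⟪x, v⟫ = 0} = ((ℝ ∙ v)ᗮ : Submodule ℝ E) := by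
    ext x
    simp [Submodule.mem_orthogonal_singleton_iff_inner_left]
  rw [hset]
  refine Measure.addHaar_submodule _ _ fun htop => hv ?_
  have : v ∈ ((ℝ ∙ v)ᗮ : Submodule ℝ E) := htop ▸ Submodule.mem_top
  rwa [Submodule.mem_orthogonal_singleton_iff_inner_left, inner_self_eq_zero] at this

/-- Compactness of the sphere: if slabs of width tending to zero all kept mass above δ, their
normals would subconverge to some w. The slabs then leave every point off the hyperplane orthogonal
to w, which is null. -/
theorem exists_slab_measure_le {vol ν : Measure E} [vol.IsAddHaarMeasure] [IsFiniteMeasure ν]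
    (hν : ν ≪ vol) {δ : ℝ≥0∞} (hδ : δ ≠ 0) :
    ∃ r : ℝ, 0 < r ∧ ∀ v : E, ‖v‖ = 1 → ν {x | |⟪x, v⟫| < r} ≤ δ := by
  by_contra! hcon
  choose v hv1 hv using fun j : ℕ => hcon (1 / ((j : ℝ) + 1)) (by positivity)
  obtain ⟨w, hw, s, hs, hlim⟩ := (isCompact_sphere (0 : E) 1).tendsto_subseq
    (x := v) (fun j => by simpa using hv1 j)
  have hw0 : w ≠ 0 := by
    rintro rfl
    simp at hw
  have hmeas : ∀ j, MeasurableSet {x | |⟪x, v (s j)⟫| < 1 / ((s j : ℝ) + 1)} := fun j =>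
    (isOpen_lt (by fun_prop) continuous_const).measurableSet
  have key : Tendsto (fun j => ν {x | |⟪x, v (s j)⟫| < 1 / ((s j : ℝ) + 1)}) atTop (𝓝 (ν ∅)) := by
    refine tendsto_measure_of_ae_tendsto_indicator_of_isFiniteMeasure _ MeasurableSet.empty hmeas ?_
    have hnull : ∀ᵐ x ∂ν, ⟪x, w⟫ ≠ 0 := by
      rw [ae_iff]
      simpa using hν (addHaar_inner_eq_zero vol hw0)
    filter_upwards [hnull] with x hx
    have h1 : Tendsto (fun j => |⟪x, v (s j)⟫|) atTop (𝓝 |⟪x, w⟫|) :=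
      ((continuous_const.inner continuous_id).abs.tendsto w).comp hlim
    have h2 : Tendsto (fun j => 1 / ((s j : ℝ) + 1)) atTop (𝓝 0) :=
      tendsto_one_div_add_atTop_nhds_zero_nat.comp hs.tendsto_atTop
    filter_upwards [h2.eventually_lt h1 (abs_pos.2 hx)] with j hj
    simpa using hj.le
  rw [measure_empty] at key
  obtain ⟨j, hj⟩ := (key.eventually_lt_const (pos_iff_ne_zero.2 hδ)).exists
  exact absurd (hv (s j)) (not_lt.2 hj.le)

/-! ### Uniform bounds -/

/-- Dominated convergence. It serves both to bound the mean of ψ along a maximising sequence and to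
discard the region where a potential exceeds a large constant. -/
theorem tendsto_lintegral_min_nexp {α : Type*} [MeasurableSpace α] {W : Measure α}
    {h : α → ℝ≥0∞} (hm : Measurable h) (hint : ∫⁻ x, h x ∂W ≠ ∞) :
    Tendsto (fun a => ∫⁻ x, min (nexp a) (h x) ∂W) (𝓝 ∞) (𝓝 0) := by
  rw [← lintegral_zero (μ := W)]
  refine tendsto_lintegral_filter_of_dominated_convergence h
    (Eventually.of_forall fun a => measurable_const.min hm)
    (Eventually.of_forall fun a => Eventually.of_forall fun x => min_le_right _ _) hint
    (Eventually.of_forall fun x => ?_)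
  have : Tendsto (fun a => min (nexp a) (h x)) (𝓝 ∞) (𝓝 (min (nexp ∞) (h x))) :=
    (continuous_nexp.min continuous_const).tendsto ∞
  simpa using this

/-- A lower bound for the integral of `e^{-φ}` yields an upper bound for `φ` on a fixed ball. -/
theorem exists_polar_le_on_ball {vol W : Measure E} [vol.IsAddHaarMeasure] (hW : W ≪ vol)
    {h : E → ℝ≥0∞} (hm : Measurable h) (hint : ∫⁻ x, h x ∂W ≠ ∞) {δ : ℝ≥0∞} (hδ : δ ≠ 0) :
    ∃ r : ℝ, 0 < r ∧ ∃ C : ℝ≥0∞, C ≠ ∞ ∧ ∀ ψ : E → ℝ≥0∞, (∀ x, nexp (polar ψ x) ≤ h x) →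
      δ ≤ ∫⁻ x, nexp (polar ψ x) ∂W → ∀ x, ‖x‖ < r → polar ψ x ≤ C := by
  by_cases hδt : δ = ∞
  · refine ⟨1, one_pos, 0, by simp, fun ψ hψ hδψ => ?_⟩
    exact absurd (hδψ.trans (lintegral_mono hψ)) (by simp [hδt, hint])
  have hδ3 : δ / 3 ≠ 0 := by simp [hδ]
  have : IsFiniteMeasure (W.withDensity h) := isFiniteMeasure_withDensity hint
  obtain ⟨r, hr, hslab⟩ := exists_slab_measure_le (vol := vol) (ν := W.withDensity h)
    ((withDensity_absolutelyContinuous _ _).trans hW) hδ3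
  have hev := (tendsto_lintegral_min_nexp hm hint).eventually_lt_const (pos_iff_ne_zero.2 hδ3)
  obtain ⟨C, hC⟩ := (ENNReal.tendsto_nat_nhds_top.eventually hev).exists
  refine ⟨r, hr, C, by simp, fun ψ hψ hδψ x hx => ?_⟩
  by_contra hlt
  rw [polar_le_iff] at hlt
  push Not at hlt
  obtain ⟨y, hy⟩ := hlt
  have hy0 : y ≠ 0 := by
    rintro rfl
    simp at hy
  have hypos : 0 < ‖y‖ := norm_pos_iff.2 hy0
  -- The vector y witnesses that the polar exceeds C at x. Any z in the sublevel set has |⟨z,y⟩| <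
  -- |⟨x,y⟩| < r‖y‖, so the sublevel set lies in a thin slab and carries little mass; above level C
  -- the integrand is at most e^{-C}. Each part contributes at most δ/3, which contradicts the lower
  -- bound δ.
  have hsub : {z | polar ψ z ≤ C} ⊆ {z | |⟪z, ‖y‖⁻¹ • y⟫| < r} := by
    intro z hz
    have h1 : ENNReal.ofReal |⟪z, y⟫| < ENNReal.ofReal |⟪x, y⟫| :=
      ((le_polar_add ψ z y).trans (by gcongr; exact hz)).trans_lt hy
    have h2 : |⟪z, y⟫| < |⟪x, y⟫| := (ENNReal.ofReal_lt_ofReal_iff'.1 h1).1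
    have h3 : |⟪x, y⟫| ≤ ‖x‖ * ‖y‖ := abs_real_inner_le_norm x y
    simp only [Set.mem_ofPred_eq, real_inner_smul_right, abs_mul, abs_inv, abs_norm]
    rw [inv_mul_lt_iff₀ hypos]
    nlinarith
  have hms : MeasurableSet {z | polar ψ z ≤ C} := measurable_polar ψ measurableSet_Iic
  have hbound : ∀ z, nexp (polar ψ z) ≤
      {z | polar ψ z ≤ C}.indicator h z + min (nexp C) (h z) := by
    intro z
    by_cases hz : polar ψ z ≤ C
    · rw [Set.indicator_of_mem (by exact hz)]
      exact (hψ z).trans le_self_add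
    · rw [Set.indicator_of_notMem (by exact hz), zero_add]
      exact le_min (nexp_antitone (not_le.1 hz).le) (hψ z)
  have h1 : ∫⁻ z, nexp (polar ψ z) ∂W ≤ δ / 3 + δ / 3 := by
    calc _ ≤ ∫⁻ z, ({z | polar ψ z ≤ C}.indicator h z + min (nexp C) (h z)) ∂W :=
          lintegral_mono hbound
      _ = W.withDensity h {z | polar ψ z ≤ C} + ∫⁻ z, min (nexp C) (h z) ∂W := by
          rw [lintegral_add_left (hm.indicator hms), lintegral_indicator hms, withDensity_apply _ hms]
      _ ≤ _ := by
          gcongr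
          refine (measure_mono hsub).trans (hslab _ ?_)
          rw [norm_smul, norm_inv, norm_norm, inv_mul_cancel₀ hypos.ne']
  have h2 := hδψ.trans h1
  have h3 : δ / 3 + δ / 3 + δ / 3 = δ := ENNReal.add_thirds δ
  have h4 : δ / 3 + δ / 3 < δ / 3 + δ / 3 + δ / 3 :=
    ENNReal.lt_add_right (by simp [ENNReal.div_eq_top, hδt]) hδ3
  rw [h3] at h4
  exact absurd h2 (not_le.2 h4)

/-! ### Selection of an almost everywhere convergent subsequence -/

/-- A subsequence converges at every point of a countable dense set, by compactness of a countable
product of copies of [0, ∞]. With U and L the upper and lower limits, convexity and the bound on the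
ball transfer this to U(a x) ≤ L(x) for all 0 < a < 1. Hence {L < q < U} meets each ray at most
once, and so is null. -/
theorem exists_subseq_limsup_polar_le_liminf (vol : Measure E) [vol.IsAddHaarMeasure]
    {ψ : ℕ → E → ℝ≥0∞} {r : ℝ} (hr : 0 < r) {C : ℝ≥0∞} (hCtop : C ≠ ∞)
    (hC : ∀ k x, ‖x‖ < r → polar (ψ k) x ≤ C) :
    ∃ s : ℕ → ℕ, StrictMono s ∧ ∀ᵐ x ∂vol,
      limsup (fun k => polar (ψ (s k)) x) atTop ≤ liminf (fun k => polar (ψ (s k)) x) atTop := by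
  obtain ⟨g, s, hs, hlim⟩ := CompactSpace.tendsto_subseq
    (fun k : ℕ => fun i : ℕ => polar (ψ k) (TopologicalSpace.denseSeq E i))
  refine ⟨s, hs, ?_⟩
  rw [tendsto_pi_nhds] at hlim
  set U : E → ℝ≥0∞ := fun x => limsup (fun k => polar (ψ (s k)) x) atTop with hU
  set L : E → ℝ≥0∞ := fun x => liminf (fun k => polar (ψ (s k)) x) atTop with hL
  have hUm : Measurable U := Measurable.limsup fun k => measurable_polar _
  have hLm : Measurable L := Measurable.liminf fun k => measurable_polar _
  -- Two dilations by a: one passes from x to a dense point q near a • x, the other from q to a • (a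
  -- • x).
  have hstep : ∀ (a : ℝ) (x : E), 0 < a → a < 1 →
      U ((a * a) • x) ≤ L x + ENNReal.ofReal (1 - a) * C + ENNReal.ofReal (1 - a) * C := by
    intro a x ha ha'
    have h1 : 0 < (1 - a) * r := mul_pos (sub_pos.2 ha') hr
    obtain ⟨i, hi⟩ : ∃ i, dist (a • x) (TopologicalSpace.denseSeq E i) < (1 - a) * r :=
      (TopologicalSpace.denseRange_denseSeq E).exists_dist_lt _ h1
    set q := TopologicalSpace.denseSeq E i
    rw [dist_eq_norm] at hi
    have hUq : U ((a * a) • x) ≤ g i + ENNReal.ofReal (1 - a) * C := by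
      have ht : Tendsto (fun k => polar (ψ (s k)) q + ENNReal.ofReal (1 - a) * C) atTop
          (𝓝 (g i + ENNReal.ofReal (1 - a) * C)) := (hlim i).add_const _
      rw [← ht.limsup_eq]
      refine limsup_le_limsup (Eventually.of_forall fun k => ?_)
      refine polar_le_of_mem_ball (hC (s k)) ha ha' ?_
      rw [mul_smul, ← smul_sub, norm_smul, Real.norm_of_nonneg ha.le]
      nlinarith [norm_nonneg (a • x - q)]
    have hLq : g i ≤ L x + ENNReal.ofReal (1 - a) * C := by
      have hrw : L x + ENNReal.ofReal (1 - a) * C =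
          liminf (fun k => polar (ψ (s k)) x + ENNReal.ofReal (1 - a) * C) atTop :=
        (liminf_add_const atTop _ _ (by isBoundedDefault) (by isBoundedDefault)).symm
      rw [hrw, ← (hlim i).liminf_eq]
      refine liminf_le_liminf (Eventually.of_forall fun k => ?_)
      refine polar_le_of_mem_ball (hC (s k)) ha ha' ?_
      rwa [norm_sub_rev]
    exact hUq.trans (by gcongr)
  have hmono : ∀ (a : ℝ) (x : E), 0 < a → a < 1 → U (a • x) ≤ U x := fun a x ha ha' =>
    limsup_le_limsup (Eventually.of_forall fun k => polar_smul_le _ ha.le ha'.le x)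
  -- Let the auxiliary factor b tend to 1, keeping a < b², and use monotonicity along rays to go
  -- from b² down to a.
  have hkey : ∀ (a : ℝ) (x : E), 0 < a → a < 1 → U (a • x) ≤ L x := by
    intro a x ha ha'
    have ht : Tendsto (fun b : ℝ => L x + ENNReal.ofReal (1 - b) * C + ENNReal.ofReal (1 - b) * C)
        (𝓝[<] 1) (𝓝 (L x + 0 + 0)) := by
      have h0 : Tendsto (fun b : ℝ => ENNReal.ofReal (1 - b) * C) (𝓝[<] 1) (𝓝 0) := by
        have h00 : Tendsto (fun b : ℝ => ENNReal.ofReal (1 - b)) (𝓝[<] 1) (𝓝 0) := by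
          have : Tendsto (fun b : ℝ => ENNReal.ofReal (1 - b)) (𝓝 1) (𝓝 (ENNReal.ofReal (1 - 1))) :=
            (ENNReal.continuous_ofReal.comp (continuous_const.sub continuous_id)).tendsto 1
          simpa using this.mono_left nhdsWithin_le_nhds
        simpa using ENNReal.Tendsto.mul_const h00 (Or.inr hCtop)
      exact (tendsto_const_nhds.add h0).add h0
    rw [add_zero, add_zero] at ht
    refine ge_of_tendsto ht ?_
    have hsq : ∀ᶠ b : ℝ in 𝓝[<] 1, a < b * b := by
      have : Tendsto (fun b : ℝ => b * b) (𝓝[<] 1) (𝓝 (1 * 1)) :=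
        ((continuous_id.mul continuous_id).tendsto (1 : ℝ)).mono_left nhdsWithin_le_nhds
      exact this.eventually_const_lt (by linarith)
    filter_upwards [hsq, Ioo_mem_nhdsLT (show (0 : ℝ) < 1 by norm_num)] with b hb hb01
    refine le_trans ?_ (hstep b x hb01.1 hb01.2)
    have hbb : 0 < b * b := mul_pos hb01.1 hb01.1
    have : a • x = (a / (b * b)) • ((b * b) • x) := by
      rw [smul_smul, div_mul_cancel₀ _ hbb.ne']
    rw [this]
    exact hmono _ _ (div_pos ha hbb) ((div_lt_one hbb).2 hb)
  have hnull : ∀ q : ℚ, vol {x | L x < ENNReal.ofReal q ∧ ENNReal.ofReal q < U x} = 0 := by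
    intro q
    refine addHaar_eq_zero_of_smul_notMem vol
      ((measurableSet_lt hLm measurable_const).inter (measurableSet_lt measurable_const hUm)) ?_
    rintro x ⟨hx, -⟩ a ha ha' ⟨-, hx'⟩
    exact lt_irrefl _ ((hx'.trans_le (hkey a x ha ha')).trans hx)
  have hall : ∀ᵐ x ∂vol, ∀ q : ℚ, ¬ (L x < ENNReal.ofReal q ∧ ENNReal.ofReal q < U x) := by
    rw [ae_all_iff]
    intro q
    rw [ae_iff]
    simpa using hnull q
  filter_upwards [hall] with x hx
  by_contra hlt
  obtain ⟨q, -, hq1, hq2⟩ := ENNReal.lt_iff_exists_rat_btwn.1 (not_le.1 hlt)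
  exact hx q ⟨hq1, hq2⟩

end OrliczMinkowski

namespace OrliczMinkowski

variable {E : Type*} [NormedAddCommGroup E] [InnerProductSpace ℝ E]
  [MeasurableSpace E]

/-! ### The variational problem -/

/-- The mass `∫ e^{-φ} dW` of the log-concave function whose potential is the polar of `ψ`. -/
noncomputable def polarMass (W : Measure E) (ψ : E → ℝ≥0∞) : ℝ≥0∞ :=
  ∫⁻ x, nexp (polar ψ x) ∂W

/-- The functional to be maximised. -/
noncomputable def dualValue (W μ : Measure E) (ψ : E → ℝ≥0∞) : ℝ≥0∞ :=
  polarMass W ψ * nexp ((∫⁻ y, ψ y ∂μ) / μ Set.univ)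

variable [BorelSpace E]

/-- With the constant moved into the exponent, the integrand is dominated independently of ψ by the
coercivity bound. -/
theorem dualValue_eq (W μ : Measure E) (ψ : E → ℝ≥0∞) :
    dualValue W μ ψ = ∫⁻ x, nexp (polar ψ x + (∫⁻ y, ψ y ∂μ) / μ Set.univ) ∂W := by
  simp_rw [nexp_add]
  have hm : Measurable fun x => nexp (polar ψ x) := measurable_nexp.comp (measurable_polar ψ)
  rw [lintegral_mul_const _ hm, dualValue, polarMass]

/-- Coercivity: the polarity inequality averaged over μ. The constant a does not depend on ψ. -/
theorem ofReal_mul_norm_le_polar_add {μ : Measure E} [IsFiniteMeasure μ] (hμ : μ ≠ 0) {a : ℝ}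
    (ha : ∀ x : E, ENNReal.ofReal (a * ‖x‖) * μ Set.univ ≤ ∫⁻ y, ENNReal.ofReal |⟪x, y⟫| ∂μ)
    (ψ : E → ℝ≥0∞) (x : E) :
    ENNReal.ofReal (a * ‖x‖) ≤ polar ψ x + (∫⁻ y, ψ y ∂μ) / μ Set.univ := by
  have h0 : μ Set.univ ≠ 0 := by simpa using hμ
  have h1 : μ Set.univ ≠ ∞ := measure_ne_top _ _
  have := (ha x).trans (lintegral_inner_le (μ := μ) (ψ := ψ) x)
  rw [← ENNReal.le_div_iff_mul_le (Or.inl h0) (Or.inl h1)] at this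
  rwa [ENNReal.add_div, mul_div_assoc, ENNReal.div_self h0 h1, mul_one] at this

variable [FiniteDimensional ℝ E]

/-- Direct method. Convergence is extracted for the polars of a maximising sequence, not for the
potentials; the maximiser is the polar of their limit, which also makes it measurable and zero at
the origin. -/
theorem exists_maximizer {vol W μ : Measure E} [vol.IsAddHaarMeasure] [IsFiniteMeasure μ]
    (hμ : μ ≠ 0) (hW : W ≪ vol) (hball : W (Metric.closedBall 0 1) ≠ 0)
    (hmoment : ∫⁻ y, ENNReal.ofReal ‖y‖ ∂μ ≠ ∞) {a : ℝ}
    (ha : ∀ x : E, ENNReal.ofReal (a * ‖x‖) * μ Set.univ ≤ ∫⁻ y, ENNReal.ofReal |⟪x, y⟫| ∂μ)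
    (hint : ∫⁻ x, nexp (ENNReal.ofReal (a * ‖x‖)) ∂W ≠ ∞) :
    ∃ ψ : E → ℝ≥0∞, Measurable ψ ∧ ψ 0 = 0 ∧ ∫⁻ y, ψ y ∂μ ≠ ∞ ∧ polarMass W ψ ≠ 0 ∧ polarMass W ψ ≠ ∞ ∧
      ∀ ψ' : E → ℝ≥0∞, Measurable ψ' → dualValue W μ ψ' ≤ dualValue W μ ψ := by
  have h0 : μ Set.univ ≠ 0 := by simpa using hμ
  have h1 : μ Set.univ ≠ ∞ := measure_ne_top _ _
  set h : E → ℝ≥0∞ := fun x => nexp (ENNReal.ofReal (a * ‖x‖)) with hh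
  have hm : Measurable h := measurable_nexp.comp (by fun_prop)
  set m : (E → ℝ≥0∞) → ℝ≥0∞ := fun ψ => (∫⁻ y, ψ y ∂μ) / μ Set.univ with hmdef
  have hbound : ∀ ψ x, nexp (polar ψ x + m ψ) ≤ h x := fun ψ x =>
    nexp_antitone (ofReal_mul_norm_le_polar_add hμ ha ψ x)
  have hle : ∀ ψ, dualValue W μ ψ ≤ ∫⁻ x, min (nexp (m ψ)) (h x) ∂W := fun ψ => by
    rw [dualValue_eq]
    exact lintegral_mono fun x => le_min (nexp_antitone le_add_self) (hbound ψ x)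
  set S : Set ℝ≥0∞ := dualValue W μ '' {ψ | Measurable ψ} with hS
  have hVtop : sSup S ≠ ∞ := by
    refine ne_top_of_le_ne_top hint (sSup_le ?_)
    rintro _ ⟨ψ, -, rfl⟩
    exact (hle ψ).trans (lintegral_mono fun x => min_le_right _ _)
  have hV0 : sSup S ≠ 0 := by
    -- The trial potential ‖y‖ has finite mean, and its polar vanishes on the unit ball by
    -- Cauchy-Schwarz, so its value is positive.
    have hψ : Measurable (fun y : E => ENNReal.ofReal ‖y‖) := by fun_prop
    refine ((pos_iff_ne_zero.2 ?_).trans_le (le_sSup (Set.mem_image_of_mem _ hψ))).ne'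
    refine mul_ne_zero ?_ ?_
    · refine ((pos_iff_ne_zero.2 hball).trans_le ?_).ne'
      rw [← setLIntegral_one, polarMass]
      refine le_trans ?_ (setLIntegral_le_lintegral (Metric.closedBall (0 : E) 1) _)
      refine setLIntegral_mono' measurableSet_closedBall fun x hx => ?_
      have : polar (fun y : E => ENNReal.ofReal ‖y‖) x ≤ 0 := by
        refine polar_le_iff.2 fun y => ?_
        rw [zero_add]
        refine ENNReal.ofReal_le_ofReal ((abs_real_inner_le_norm x y).trans ?_)
        have hx1 : ‖x‖ ≤ 1 := by simpa using hx
        nlinarith [norm_nonneg y]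
      rw [nonpos_iff_eq_zero.1 this, nexp_zero]
    · rw [Ne, nexp_eq_zero_iff]
      exact ENNReal.div_ne_top hmoment h0
  obtain ⟨u, -, hu, huS⟩ := exists_seq_tendsto_sSup (S := S)
    (Set.Nonempty.image _ ⟨fun _ => 0, measurable_const⟩) (OrderTop.bddAbove _)
  choose ψ₀ hψ₀m hψ₀ using huS
  obtain ⟨m₀, s₀, hs₀, hm₀⟩ := CompactSpace.tendsto_subseq (fun k => m (ψ₀ k))
  have hval₀ : Tendsto (fun k => dualValue W μ (ψ₀ (s₀ k))) atTop (𝓝 (sSup S)) := by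
    simp only [hψ₀]
    exact hu.comp hs₀.tendsto_atTop
  -- If the means tended to infinity, the bound by the integral of min(e^{-m}, h) would force the
  -- supremum to be zero.
  have hm₀top : m₀ ≠ ∞ := by
    rintro rfl
    have hlim := (tendsto_lintegral_min_nexp hm hint).comp hm₀
    exact hV0 (nonpos_iff_eq_zero.1
      (le_of_tendsto_of_tendsto' hval₀ hlim fun k => hle _))
  have hm1 : m₀ < m₀ + 1 := ENNReal.lt_add_right hm₀top one_ne_zero
  have hhalf : sSup S / 2 < sSup S := ENNReal.half_lt_self hV0 hVtop
  obtain ⟨N, hN⟩ := eventually_atTop.1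
    ((hm₀.eventually_lt_const hm1).and (hval₀.eventually_const_lt hhalf))
  set ψ₁ : ℕ → E → ℝ≥0∞ := fun k => ψ₀ (s₀ (k + N)) with hψ₁
  have hval₁ : Tendsto (fun k => dualValue W μ (ψ₁ k)) atTop (𝓝 (sSup S)) :=
    hval₀.comp (tendsto_add_atTop_nat N)
  have hm₁ : Tendsto (fun k => m (ψ₁ k)) atTop (𝓝 m₀) := hm₀.comp (tendsto_add_atTop_nat N)
  have hne : nexp (m₀ + 1) ≠ 0 := by
    rw [Ne, nexp_eq_zero_iff]
    exact ENNReal.add_ne_top.2 ⟨hm₀top, ENNReal.one_ne_top⟩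
  -- Past the index N the mean is at most m₀ + 1, so e^{-φ} ≤ h / e^{-(m₀+1)}, and the mass is at
  -- least half the supremum.
  obtain ⟨r, hr, C, hCtop, hC⟩ := exists_polar_le_on_ball (vol := vol) hW
    (h := fun x => h x / nexp (m₀ + 1)) (hm.div_const _)
    (by
      simp_rw [div_eq_mul_inv]
      rw [lintegral_mul_const _ hm]
      exact ENNReal.mul_ne_top hint (ENNReal.inv_ne_top.2 hne))
    (δ := sSup S / 2) (by simp [hV0])
  have hC₁ : ∀ k x, ‖x‖ < r → polar (ψ₁ k) x ≤ C := by
    intro k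
    obtain ⟨hk1, hk2⟩ := hN (k + N) (Nat.le_add_left _ _)
    refine hC (ψ₁ k) (fun x => ?_) (hk2.le.trans ?_)
    · rw [ENNReal.le_div_iff_mul_le (Or.inl hne) (Or.inl (nexp_ne_top _)), ← nexp_add]
      exact (nexp_antitone (by gcongr; exact hk1.le)).trans (hbound (ψ₁ k) x)
    · exact mul_le_of_le_one_right' (nexp_le_one _)
  obtain ⟨s, hs, hae⟩ := exists_subseq_limsup_polar_le_liminf vol hr hCtop hC₁
  set U : E → ℝ≥0∞ := fun x => limsup (fun k => polar (ψ₁ (s k)) x) atTop with hU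
  set ψ := polar U with hψ
  have hψm : Measurable ψ := measurable_polar U
  have hm₂ := hm₁.comp hs.tendsto_atTop
  have hψle : ∀ y, ψ y ≤ liminf (fun k => ψ₁ (s k) y) atTop := by
    intro y
    refine iSup_le fun x => ?_
    rw [← ENNReal.liminf_const_sub _ _ ENNReal.ofReal_ne_top]
    refine liminf_le_liminf (Eventually.of_forall fun k => ?_)
    rw [tsub_le_iff_left, real_inner_comm]
    exact le_polar_add _ _ _
  have hmψ : m ψ ≤ m₀ := by
    rw [← hm₂.liminf_eq]
    have hrw : liminf (m ∘ ψ₁ ∘ s) atTop =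
        liminf (fun k => ∫⁻ y, ψ₁ (s k) y ∂μ) atTop / μ Set.univ := by
      simp only [hmdef, Function.comp_def, div_eq_mul_inv]
      refine (Monotone.map_liminf_of_continuousAt (f := fun t : ℝ≥0∞ => t * (μ Set.univ)⁻¹)
        (fun _ _ hab => mul_le_mul_left hab _) (fun k => ∫⁻ y, ψ₁ (s k) y ∂μ) ?_).symm
      exact (ENNReal.continuous_mul_const (ENNReal.inv_ne_top.2 h0)).continuousAt
    have hF : ∫⁻ y, ψ y ∂μ ≤ liminf (fun k => ∫⁻ y, ψ₁ (s k) y ∂μ) atTop :=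
      (lintegral_mono hψle).trans (lintegral_liminf_le fun k => hψ₀m _)
    exact (ENNReal.div_le_div_right hF _).trans_eq hrw.symm
  have hlim : Tendsto (fun k => dualValue W μ (ψ₁ (s k))) atTop
      (𝓝 (∫⁻ x, nexp (U x + m₀) ∂W)) := by
    simp_rw [dualValue_eq]
    refine tendsto_lintegral_of_dominated_convergence h
      (fun k => measurable_nexp.comp ((measurable_polar _).add_const _))
      (fun k => Eventually.of_forall (hbound _)) hint ?_
    filter_upwards [hW.ae_le hae] with x hx
    have hx' : Tendsto (fun k => polar (ψ₁ (s k)) x) atTop (𝓝 (U x)) :=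
      tendsto_of_le_liminf_of_limsup_le hx le_rfl
    exact (continuous_nexp.tendsto _).comp (hx'.add hm₂)
  have hVeq : sSup S = ∫⁻ x, nexp (U x + m₀) ∂W :=
    tendsto_nhds_unique (hval₁.comp hs.tendsto_atTop) hlim
  -- Biduality: the polar of ψ is the double polar of U, hence at most U. Both terms in the exponent
  -- improve on the limit.
  have hVle : sSup S ≤ dualValue W μ ψ := by
    rw [hVeq, dualValue_eq]
    exact lintegral_mono fun x => nexp_antitone (add_le_add (polar_polar_le U x) hmψ)
  have hpos : dualValue W μ ψ ≠ 0 := ((pos_iff_ne_zero.2 hV0).trans_le hVle).ne'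
  have hMtop : m ψ ≠ ∞ := ne_top_of_le_ne_top hm₀top hmψ
  have hne' : nexp (m ψ) ≠ 0 := by rwa [Ne, nexp_eq_zero_iff]
  refine ⟨ψ, hψm, polar_zero U, fun htop => hMtop ?_, left_ne_zero_of_mul hpos, fun htop => ?_,
    fun ψ' hψ' => (le_sSup (Set.mem_image_of_mem _ hψ')).trans hVle⟩
  · simp only [hmdef, htop]
    exact ENNReal.top_div_of_ne_top h1
  · refine ne_top_of_le_ne_top hint ((hle ψ).trans (lintegral_mono fun x => min_le_right _ _)) ?_
    rw [dualValue, htop]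
    exact ENNReal.top_mul hne'

end OrliczMinkowski

open scoped NNReal

namespace OrliczMinkowski

/-! ### First variation -/

section Pointwise

variable {E : Type*} [NormedAddCommGroup E] [InnerProductSpace ℝ E]

/-- Approximate subgradients at a point of differentiability converge to the gradient. -/
theorem tendsto_of_approx_subgradient [CompleteSpace E] {Φ : E → ℝ} {p x : E}
    (hΦ : HasGradientAt Φ p x) {y : ℕ → E} {δ : ℕ → ℝ} (hδ : Tendsto δ atTop (𝓝 0))
    (h : ∀ᶠ z in 𝓝 x, ∀ j, Φ x + ⟪z - x, y j⟫ - δ j ≤ Φ z) : Tendsto y atTop (𝓝 p) := by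
  rw [Metric.tendsto_nhds]
  intro ε hε
  have h1 := (hasFDerivAt_iff_isLittleO.1 hΦ.hasFDerivAt).bound (show 0 < ε / 3 by positivity)
  obtain ⟨ρ, hρ, hball⟩ := Metric.eventually_nhds_iff.1 (h1.and h)
  have hs : 0 < ρ / 2 := by positivity
  filter_upwards [hδ.eventually_lt_const (show 0 < ε / 3 * (ρ / 2) by positivity)] with j hj
  by_contra hcon
  rw [dist_eq_norm, not_lt] at hcon
  have hN : 0 < ‖y j - p‖ := hε.trans_le hcon
  -- Test at distance ρ/2 in the direction y j - p. The linear gain is at least ε·ρ/2, while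
  -- differentiability and δ j each allow only ε/3·ρ/2.
  set z := x + (ρ / 2 / ‖y j - p‖) • (y j - p) with hz
  have hzx : z - x = (ρ / 2 / ‖y j - p‖) • (y j - p) := by simp [hz]
  have hnorm : ‖z - x‖ = ρ / 2 := by
    rw [hzx, norm_smul, Real.norm_of_nonneg (by positivity), div_mul_cancel₀ _ hN.ne']
  obtain ⟨h2, h3⟩ := hball (show dist z x < ρ by rw [dist_eq_norm, hnorm]; linarith)
  have h4 : ⟪z - x, y j - p⟫ = ρ / 2 * ‖y j - p‖ := by
    rw [hzx, real_inner_smul_left, real_inner_self_eq_norm_sq]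
    field_simp
  rw [inner_sub_right] at h4
  rw [hnorm, InnerProductSpace.toDual_apply_apply, real_inner_comm, Real.norm_eq_abs] at h2
  have h5 := (abs_le.1 h2).2
  have h6 := h3 j
  have h7 : ρ / 2 * ε ≤ ρ / 2 * ‖y j - p‖ := by gcongr
  nlinarith

/-- Near maximisers for the polar of a function normalised to have infimum zero. -/
theorem exists_polar_sub_iInf_le {ψ : E → ℝ≥0∞} (hm : ⨅ y, ψ y ≠ ∞) {x : E}
    (hx : polar (fun y => ψ y - ⨅ y, ψ y) x ≠ ∞) {ε : ℝ} (hε : 0 < ε) :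
    ∃ y, ψ y ≠ ∞ ∧ (polar (fun y => ψ y - ⨅ y, ψ y) x).toReal ≤
      |⟪x, y⟫| - (ψ y).toReal + (⨅ y, ψ y).toReal + ε := by
  set m := ⨅ y, ψ y with hmdef
  have hε' : ENNReal.ofReal ε ≠ 0 := by simpa using hε
  by_cases h0 : polar (fun y => ψ y - m) x = 0
  · obtain ⟨y, hy⟩ := iInf_lt_iff.1 (ENNReal.lt_add_right hm hε')
    have hyt : ψ y ≠ ∞ := (hy.trans_le le_top).ne
    refine ⟨y, hyt, ?_⟩
    have := ENNReal.toReal_mono (ENNReal.add_ne_top.2 ⟨hm, ENNReal.ofReal_ne_top⟩) hy.le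
    rw [ENNReal.toReal_add hm ENNReal.ofReal_ne_top, ENNReal.toReal_ofReal hε.le] at this
    rw [h0, ENNReal.toReal_zero]
    linarith [abs_nonneg ⟪x, y⟫]
  · obtain ⟨y, hy⟩ := lt_iSup_iff.1 (ENNReal.sub_lt_self hx h0 hε')
    change polar (fun y => ψ y - m) x - ENNReal.ofReal ε < ENNReal.ofReal |⟪x, y⟫| - (ψ y - m) at hy
    have hlt : ψ y - m < ENNReal.ofReal |⟪x, y⟫| := tsub_pos_iff_lt.1 (zero_le.trans_lt hy)
    have hyt : ψ y ≠ ∞ := fun htop => by simp [htop, ENNReal.top_sub hm] at hlt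
    refine ⟨y, hyt, ?_⟩
    have h1 := ENNReal.toReal_mono (ENNReal.add_ne_top.2
      ⟨ENNReal.sub_ne_top ENNReal.ofReal_ne_top, ENNReal.ofReal_ne_top⟩) (tsub_le_iff_right.1 hy.le)
    rw [ENNReal.toReal_add (ENNReal.sub_ne_top ENNReal.ofReal_ne_top) ENNReal.ofReal_ne_top,
      ENNReal.toReal_sub_of_le hlt.le ENNReal.ofReal_ne_top,
      ENNReal.toReal_sub_of_le (show m ≤ ψ y from iInf_le ψ y) hyt, ENNReal.toReal_ofReal (abs_nonneg _),
      ENNReal.toReal_ofReal hε.le] at h1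
    linarith

/-- The potential `ψ + t g`, normalised to have infimum zero. -/
noncomputable def perturb (ψ : E → ℝ≥0∞) (g : E → ℝ≥0) (t : ℝ≥0) (y : E) : ℝ≥0∞ :=
  ψ y + t * g y - ⨅ y, (ψ y + t * g y)

/-- Adding t g ≥ 0 can only lower the polar, and subtracting the infimum raises it by at most that
infimum. This makes the difference quotients of the first variation nonnegative, as Fatou requires.
-/
theorem polar_perturb_le (ψ : E → ℝ≥0∞) (g : E → ℝ≥0) (t : ℝ≥0) (x : E) :
    polar (perturb ψ g t) x ≤ polar ψ x + ⨅ y, (ψ y + t * g y) := by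
  refine polar_le_iff.2 fun y => ?_
  calc ENNReal.ofReal |⟪x, y⟫| ≤ polar ψ x + ψ y := le_polar_add ψ x y
    _ ≤ polar ψ x + (ψ y + t * g y) := by gcongr; exact le_self_add
    _ ≤ polar ψ x + ((⨅ y, (ψ y + t * g y)) + perturb ψ g t y) := by
        rw [perturb]
        exact add_le_add le_rfl le_add_tsub
    _ = _ := (add_assoc _ _ _).symm

theorem iInf_add_mul_le {E : Type*} [Zero E] {ψ : E → ℝ≥0∞} (hψ : ψ 0 = 0) {g : E → ℝ≥0} {B : ℝ≥0}
    (hB : ∀ y, g y ≤ B) (t : ℝ≥0) : ⨅ y, (ψ y + t * g y) ≤ t * B := by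
  refine (iInf_le _ 0).trans ?_
  rw [hψ, zero_add]
  gcongr
  exact hB 0

/-- Quantitative converse: the perturbation t g is at most t B. This makes near-maximisers for the
perturbed potential approximate subgradients of the unperturbed polar. -/
theorem polar_add_iInf_le {ψ : E → ℝ≥0∞} (hψ : ψ 0 = 0) {g : E → ℝ≥0} {B : ℝ≥0}
    (hB : ∀ y, g y ≤ B) (t : ℝ≥0) (x : E) :
    polar ψ x + ⨅ y, (ψ y + t * g y) ≤ polar (perturb ψ g t) x + t * B := by
  have hm := iInf_add_mul_le hψ hB t
  set m := ⨅ y, (ψ y + t * g y) with hmdef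
  rw [polar, ENNReal.iSup_add]
  refine iSup_le fun y => ?_
  rcases le_total (ENNReal.ofReal |⟪x, y⟫|) (ψ y) with h | h
  · rw [tsub_eq_zero_of_le h, zero_add]
    exact hm.trans le_add_self
  · have hψy : ψ y ≠ ∞ := ne_top_of_le_ne_top ENNReal.ofReal_ne_top h
    rw [← ENNReal.add_le_add_iff_right hψy, add_right_comm, tsub_add_cancel_of_le h]
    calc ENNReal.ofReal |⟪x, y⟫| + m ≤ polar (perturb ψ g t) x + perturb ψ g t y + m := by
          gcongr
          exact le_polar_add _ _ _
      _ = polar (perturb ψ g t) x + (ψ y + t * g y) := by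
          rw [add_assoc, perturb, tsub_add_cancel_of_le (iInf_le (fun y => ψ y + t * g y) y)]
      _ ≤ polar (perturb ψ g t) x + (ψ y + t * B) := by
          gcongr
          exact hB y
      _ = _ := by ring

theorem tendsto_inv_succ_nnreal :
    Tendsto (fun j : ℕ => ((j : ℝ≥0) + 1)⁻¹) atTop (𝓝 0) := by
  have := tendsto_one_div_add_atTop_nhds_zero_nat (𝕜 := ℝ)
  rw [← NNReal.tendsto_coe]
  simpa [one_div] using this

/-- Pointwise lower bound for the first variation at a point of differentiability. -/
theorem le_liminf_variation [CompleteSpace E] {ψ : E → ℝ≥0∞} (hψ : ψ 0 = 0) {g : E → ℝ≥0}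
    (hg : Continuous g) (hgeven : ∀ y, g (-y) = g y) {B : ℝ≥0} (hB : ∀ y, g y ≤ B) {p x : E}
    (hx : x ∈ interior {z | polar ψ z ≠ ∞})
    (hp : HasGradientAt (fun z => (polar ψ z).toReal) p x) {t : ℕ → ℝ≥0} (ht0 : ∀ j, 0 < t j)
    (ht : Tendsto t atTop (𝓝 0)) :
    nexp (polar ψ x) * g p ≤ liminf (fun j => (nexp (polar (perturb ψ g (t j)) x) /
      nexp (⨅ y, (ψ y + t j * g y)) - nexp (polar ψ x)) / t j) atTop := by
  have hxtop : polar ψ x ≠ ∞ := interior_subset hx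
  set m : ℕ → ℝ≥0∞ := fun j => ⨅ y, (ψ y + t j * g y) with hm
  have hmtop : ∀ j, m j ≠ ∞ := fun j => ne_top_of_le_ne_top
    (ENNReal.mul_ne_top ENNReal.coe_ne_top ENNReal.coe_ne_top) (iInf_add_mul_le hψ hB (t j))
  have hptop : ∀ j, polar (perturb ψ g (t j)) x ≠ ∞ := fun j => ne_top_of_le_ne_top
    (ENNReal.add_ne_top.2 ⟨hxtop, hmtop j⟩) (polar_perturb_le ψ g (t j) x)
  -- A near-maximiser with error t², replaced by its negative if needed so that ⟨x,y⟩ ≥ 0; evenness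
  -- of g makes this harmless. The offset c is ψ at the near-maximiser. An error of order t²
  -- disappears after division by t.
  have hex : ∀ j, ∃ (y : E) (c : ℝ),
      (∀ z, polar ψ z ≠ ∞ → ⟪z, y⟫ - c ≤ (polar ψ z).toReal) ∧
      (polar (perturb ψ g (t j)) x).toReal ≤
        ⟪x, y⟫ - c - t j * g y + (m j).toReal + t j * t j := by
    intro j
    obtain ⟨y, hy, hle⟩ := exists_polar_sub_iInf_le (hmtop j) (hptop j)
      (ε := t j * t j) (by have := ht0 j; positivity)
    have hψy : ψ y ≠ ∞ := (ENNReal.add_ne_top.1 hy).1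
    change (polar (perturb ψ g (t j)) x).toReal ≤ _ at hle
    rw [ENNReal.toReal_add hψy (ENNReal.add_ne_top.1 hy).2, ENNReal.toReal_mul,
      ENNReal.coe_toReal, ENNReal.coe_toReal] at hle
    have hz : ∀ z, polar ψ z ≠ ∞ → |⟪z, y⟫| - (ψ y).toReal ≤ (polar ψ z).toReal := by
      intro z hz
      have := ENNReal.toReal_mono (ENNReal.add_ne_top.2 ⟨hz, hψy⟩) (le_polar_add ψ z y)
      rw [ENNReal.toReal_add hz hψy, ENNReal.toReal_ofReal (abs_nonneg _)] at this
      linarith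
    rcases le_total 0 ⟪x, y⟫ with hs | hs
    · rw [abs_of_nonneg hs] at hle
      exact ⟨y, (ψ y).toReal, fun z hz' => (by linarith [hz z hz', le_abs_self ⟪z, y⟫]),
        by linarith⟩
    · rw [abs_of_nonpos hs] at hle
      refine ⟨-y, (ψ y).toReal, fun z hz' => ?_, ?_⟩
      · rw [inner_neg_right]
        linarith [hz z hz', neg_abs_le ⟪z, y⟫]
      · rw [inner_neg_right, hgeven]
        linarith
  choose y c hsub hle using hex
  have hlow : ∀ j, (polar ψ x).toReal + (m j).toReal ≤
      (polar (perturb ψ g (t j)) x).toReal + t j * B := by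
    intro j
    have hfin : (t j : ℝ≥0∞) * B ≠ ∞ := ENNReal.mul_ne_top ENNReal.coe_ne_top ENNReal.coe_ne_top
    have := ENNReal.toReal_mono (ENNReal.add_ne_top.2 ⟨hptop j, hfin⟩)
      (polar_add_iInf_le hψ hB (t j) x)
    rwa [ENNReal.toReal_add hxtop (hmtop j), ENNReal.toReal_add (hptop j) hfin,
      ENNReal.toReal_mul, ENNReal.coe_toReal, ENNReal.coe_toReal] at this
  have ht' : Tendsto (fun j => (t j : ℝ)) atTop (𝓝 0) := NNReal.tendsto_coe.2 ht
  -- Combining the two bounds, y j is a subgradient of the polar at x up to t B + t², so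
  -- differentiability forces convergence to the gradient.
  have hy : Tendsto y atTop (𝓝 p) := by
    refine tendsto_of_approx_subgradient hp (δ := fun j => t j * B + t j * t j) ?_ ?_
    · simpa using (ht'.mul_const (B : ℝ)).add (ht'.mul ht')
    · filter_upwards [isOpen_interior.mem_nhds hx] with z hz j
      have h1 := hsub j z (interior_subset hz)
      have h2 := hle j
      have h3 := hlow j
      have h4 : (0 : ℝ) ≤ t j * g (y j) := by positivity
      rw [inner_sub_left]
      linarith
  set f := Real.exp (-(polar ψ x).toReal) with hf
  have hfpos : 0 < f := Real.exp_pos _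
  -- The bound comes from exp s ≥ 1 + s with s = t (g(y) - t).
  have hterm : ∀ j, ENNReal.ofReal (f * (g (y j) - t j)) ≤
      (nexp (polar (perturb ψ g (t j)) x) / nexp (m j) - nexp (polar ψ x)) / t j := by
    intro j
    have htj : (0 : ℝ) < t j := ht0 j
    rw [nexp_of_ne_top (hptop j), nexp_of_ne_top (hmtop j), nexp_of_ne_top hxtop,
      ← ENNReal.ofReal_div_of_pos (Real.exp_pos _), ← Real.exp_sub,
      ← ENNReal.ofReal_sub _ (Real.exp_pos _).le, ← ENNReal.ofReal_coe_nnreal (p := t j),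
      ← ENNReal.ofReal_div_of_pos htj]
    refine ENNReal.ofReal_le_ofReal ?_
    rw [le_div_iff₀ htj]
    have h1 := hsub j x hxtop
    have h2 := hle j
    calc f * (g (y j) - t j) * t j = f * ((t j * (g (y j) - t j) + 1) - 1) := by ring
      _ ≤ f * (Real.exp (t j * (g (y j) - t j)) - 1) := by
          gcongr
          exact Real.add_one_le_exp _
      _ = Real.exp (-(polar ψ x).toReal + t j * (g (y j) - t j)) - f := by
          rw [Real.exp_add, mul_sub, mul_one]
      _ ≤ _ := by
          gcongr
          linarith
  have hlim : Tendsto (fun j => ENNReal.ofReal (f * (g (y j) - t j))) atTop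
      (𝓝 (nexp (polar ψ x) * g p)) := by
    have hgy : Tendsto (fun j => (g (y j) : ℝ)) atTop (𝓝 (g p : ℝ)) :=
      NNReal.tendsto_coe.2 ((hg.tendsto p).comp hy)
    have := ENNReal.tendsto_ofReal ((hgy.sub ht').const_mul f)
    rwa [sub_zero, ENNReal.ofReal_mul hfpos.le, ENNReal.ofReal_coe_nnreal, hf,
      ← nexp_of_ne_top hxtop] at this
  rw [← hlim.liminf_eq]
  exact liminf_le_liminf (Eventually.of_forall hterm)

end Pointwise

end OrliczMinkowski

namespace OrliczMinkowski

/-! ### Integrated first variation at a maximiser -/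

section Variation

variable {E : Type*} [NormedAddCommGroup E] [InnerProductSpace ℝ E]

/-- The set of points at which the polar of `ψ` is finite nearby and differentiable. -/
def diffDomain (ψ : E → ℝ≥0∞) : Set E :=
  {x | x ∈ interior {z | polar ψ z ≠ ∞} ∧ DifferentiableAt ℝ (fun z => (polar ψ z).toReal) x}

variable [MeasurableSpace E] [BorelSpace E]

theorem measurableSet_diffDomain (ψ : E → ℝ≥0∞) : MeasurableSet (diffDomain ψ) :=
  isOpen_interior.measurableSet.inter (measurableSet_of_differentiableAt ℝ _)

variable [CompleteSpace E]

/-- A maximiser satisfies the inequality form of the Euler-Lagrange equation. -/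
theorem setLIntegral_gradient_le {W μ : Measure E} [IsFiniteMeasure μ] (hμ : μ ≠ 0)
    {ψ : E → ℝ≥0∞} (hψm : Measurable ψ) (hψ0 : ψ 0 = 0) (hψint : ∫⁻ y, ψ y ∂μ ≠ ∞)
    (hJ : polarMass W ψ ≠ ∞)
    (hmax : ∀ ψ' : E → ℝ≥0∞, Measurable ψ' → dualValue W μ ψ' ≤ dualValue W μ ψ)
    {g : E → ℝ≥0} (hg : Continuous g) (hgeven : ∀ y, g (-y) = g y) {B : ℝ≥0}
    (hB : ∀ y, g y ≤ B) :
    ∫⁻ x in diffDomain ψ, nexp (polar ψ x) * g (gradient (fun z => (polar ψ z).toReal) x) ∂W ≤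
      polarMass W ψ * ((∫⁻ y, g y ∂μ) / μ Set.univ) := by
  have h0 : μ Set.univ ≠ 0 := by simpa using hμ
  have h1 : μ Set.univ ≠ ∞ := measure_ne_top _ _
  have hgm : Measurable fun y => (g y : ℝ≥0∞) := hg.measurable.coe_nnreal_ennreal
  set I := (∫⁻ y, (g y : ℝ≥0∞) ∂μ) / μ Set.univ with hI
  have hItop : I ≠ ∞ := by
    refine ENNReal.div_ne_top (ne_top_of_le_ne_top ?_
      (lintegral_mono fun y => ENNReal.coe_le_coe.2 (hB y))) h0
    rw [lintegral_const]
    exact ENNReal.mul_ne_top ENNReal.coe_ne_top h1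
  set t : ℕ → ℝ≥0 := fun j => ((j : ℝ≥0) + 1)⁻¹ with htdef
  have ht0 : ∀ j, 0 < t j := fun j => by positivity
  have ht : Tendsto t atTop (𝓝 0) := tendsto_inv_succ_nnreal
  set m : ℕ → ℝ≥0∞ := fun j => ⨅ y, (ψ y + t j * g y) with hm
  have hmtop : ∀ j, m j ≠ ∞ := fun j => ne_top_of_le_ne_top
    (ENNReal.mul_ne_top ENNReal.coe_ne_top ENNReal.coe_ne_top) (iInf_add_mul_le hψ0 hB (t j))
  have hmexp : ∀ j, nexp (m j) ≠ 0 := fun j => by rw [Ne, nexp_eq_zero_iff]; exact hmtop j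
  have hnm : ∀ ψ : E → ℝ≥0∞, Measurable fun x => nexp (polar ψ x) := fun ψ =>
    measurable_nexp.comp (measurable_polar ψ)
  -- Maximality tested on the perturbed potential. The mean of the normalised perturbation plus its
  -- infimum m j equals the mean of ψ plus t times the mean I of g.
  have hmass : ∀ j, polarMass W (perturb ψ g (t j)) * nexp (t j * I) ≤
      polarMass W ψ * nexp (m j) := by
    intro j
    have hpm : Measurable (perturb ψ g (t j)) := (hψm.add (hgm.const_mul _)).sub_const _
    have hbal : (∫⁻ y, perturb ψ g (t j) y ∂μ) / μ Set.univ + m j =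
        (∫⁻ y, ψ y ∂μ) / μ Set.univ + t j * I := by
      have : ∫⁻ y, (perturb ψ g (t j) y + m j) ∂μ = ∫⁻ y, (ψ y + t j * g y) ∂μ :=
        lintegral_congr fun y => tsub_add_cancel_of_le (iInf_le (fun y => ψ y + t j * g y) y)
      rw [lintegral_add_right _ measurable_const, lintegral_const,
        lintegral_add_left hψm, lintegral_const_mul _ hgm] at this
      rw [hI, ← mul_div_assoc, ← ENNReal.add_div, ← this, ENNReal.add_div, mul_div_assoc,
        ENNReal.div_self h0 h1, mul_one]
    have hM : nexp ((∫⁻ y, ψ y ∂μ) / μ Set.univ) ≠ 0 := by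
      rw [Ne, nexp_eq_zero_iff]
      exact ENNReal.div_ne_top hψint h0
    rw [← ENNReal.mul_le_mul_iff_left hM (nexp_ne_top _)]
    calc _ = dualValue W μ (perturb ψ g (t j)) * nexp (m j) := by
          rw [dualValue, mul_assoc, mul_assoc, ← nexp_add, ← nexp_add, hbal, add_comm]
      _ ≤ dualValue W μ ψ * nexp (m j) := by gcongr; exact hmax _ hpm
      _ = _ := by rw [dualValue]; ring
  set D : ℕ → E → ℝ≥0∞ := fun j x => (nexp (polar (perturb ψ g (t j)) x) / nexp (m j) -
    nexp (polar ψ x)) / t j with hD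
  have hDm : ∀ j, Measurable (D j) := fun j => (((hnm _).div_const _).sub (hnm _)).div_const _
  -- The mass comparison bounds the integral by a difference quotient of s ↦ exp(s I) at 0, whose
  -- limit is I.
  have hDint : ∀ j, ∫⁻ x, D j x ∂W ≤
      ENNReal.ofReal ((polarMass W ψ).toReal * ((Real.exp (t j * I.toReal) - 1) / t j)) := by
    intro j
    have htj : (0 : ℝ) < t j := ht0 j
    have htI : (t j : ℝ≥0∞) * I ≠ ∞ := ENNReal.mul_ne_top ENNReal.coe_ne_top hItop
    have hsm : Measurable fun x => nexp (polar (perturb ψ g (t j)) x) * (nexp (m j))⁻¹ -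
        nexp (polar ψ x) := ((hnm _).mul_const _).sub (hnm _)
    simp only [hD, div_eq_mul_inv (_ - nexp _), div_eq_mul_inv (nexp _)]
    rw [lintegral_mul_const _ hsm, lintegral_sub (hnm _) hJ]
    · rw [lintegral_mul_const _ (hnm _)]
      change (polarMass W (perturb ψ g (t j)) * _ - polarMass W ψ) * _ ≤ _
      have h2 : polarMass W (perturb ψ g (t j)) * (nexp (m j))⁻¹ ≤
          polarMass W ψ * (nexp (t j * I))⁻¹ := by
        have hne : nexp (t j * I) ≠ 0 := by rwa [Ne, nexp_eq_zero_iff]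
        rw [← div_eq_mul_inv, ← div_eq_mul_inv,
          ENNReal.div_le_iff (hmexp j) (nexp_ne_top _), ← ENNReal.mul_div_right_comm,
          ENNReal.le_div_iff_mul_le (Or.inl hne) (Or.inl (nexp_ne_top _))]
        exact hmass j
      refine (mul_le_mul_left (tsub_le_tsub_right h2 _) _).trans_eq ?_
      rw [nexp_of_ne_top htI, ENNReal.toReal_mul, ENNReal.coe_toReal,
        ← ENNReal.ofReal_inv_of_pos (Real.exp_pos _), ← Real.exp_neg, neg_neg]
      conv_lhs => rw [← ENNReal.ofReal_toReal hJ, ← ENNReal.ofReal_coe_nnreal (p := t j)]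
      rw [← ENNReal.ofReal_inv_of_pos htj, ← ENNReal.ofReal_mul ENNReal.toReal_nonneg,
        ← ENNReal.ofReal_sub _ ENNReal.toReal_nonneg, ← ENNReal.ofReal_mul']
      · congr 1
        field_simp
      · positivity
    · refine Eventually.of_forall fun x => ?_
      change nexp (polar ψ x) ≤ nexp (polar (perturb ψ g (t j)) x) * (nexp (m j))⁻¹
      rw [← div_eq_mul_inv, ENNReal.le_div_iff_mul_le (Or.inl (hmexp j)) (Or.inl (nexp_ne_top _)),
        ← nexp_add]
      exact nexp_antitone (polar_perturb_le ψ g (t j) x)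
  have hlim : Tendsto (fun j => ENNReal.ofReal ((polarMass W ψ).toReal *
      ((Real.exp (t j * I.toReal) - 1) / t j))) atTop (𝓝 (polarMass W ψ * I)) := by
    have hder : HasDerivAt (fun s : ℝ => Real.exp (s * I.toReal)) I.toReal 0 := by
      have := ((hasDerivAt_id (0 : ℝ)).mul_const I.toReal).exp
      simpa using this
    have hslope := hder.tendsto_slope
    have ht' : Tendsto (fun j => (t j : ℝ)) atTop (𝓝[≠] 0) :=
      tendsto_nhdsWithin_iff.2 ⟨NNReal.tendsto_coe.2 ht, Eventually.of_forall fun j => by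
        have : (0 : ℝ) < t j := ht0 j
        exact this.ne'⟩
    have := ENNReal.tendsto_ofReal ((hslope.comp ht').const_mul (polarMass W ψ).toReal)
    rw [ENNReal.ofReal_mul ENNReal.toReal_nonneg, ENNReal.ofReal_toReal hJ,
      ENNReal.ofReal_toReal hItop] at this
    refine this.congr fun j => ?_
    simp [slope_def_field]
  calc _ ≤ ∫⁻ x in diffDomain ψ, liminf (fun j => D j x) atTop ∂W :=
        setLIntegral_mono' (measurableSet_diffDomain ψ) fun x hx =>
          le_liminf_variation hψ0 hg hgeven hB hx.1 hx.2.hasGradientAt ht0 ht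
    _ ≤ ∫⁻ x, liminf (fun j => D j x) atTop ∂W := setLIntegral_le_lintegral _ _
    _ ≤ liminf (fun j => ∫⁻ x, D j x ∂W) atTop := lintegral_liminf_le hDm
    _ ≤ liminf _ atTop := liminf_le_liminf (Eventually.of_forall hDint)
    _ = _ := hlim.liminf_eq

end Variation

end OrliczMinkowski

namespace OrliczMinkowski

/-! ### Almost everywhere differentiability and symmetry -/

section Differentiability

variable {E : Type*} [NormedAddCommGroup E] [InnerProductSpace ℝ E] [FiniteDimensional ℝ E]
  [MeasurableSpace E] [BorelSpace E]

/-- Rademacher's theorem on a neighbourhood of each point; a locally null set is null. -/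
theorem _root_.LocallyLipschitzOn.ae_differentiableAt_of_isOpen (vol : Measure E)
    [vol.IsAddHaarMeasure] {f : E → ℝ} {s : Set E} (hf : LocallyLipschitzOn s f) (hs : IsOpen s) :
    ∀ᵐ x ∂vol, x ∈ s → DifferentiableAt ℝ f x := by
  rw [ae_iff]
  refine measure_null_of_locally_null _ fun x hx => ?_
  simp only [Set.mem_ofPred_eq, Classical.not_imp] at hx
  obtain ⟨K, t, ht, hK⟩ := hf hx.1
  rw [hs.nhdsWithin_eq hx.1] at ht
  refine ⟨_, inter_mem_nhdsWithin _ (interior_mem_nhds.2 ht), ?_⟩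
  refine measure_mono_null ?_ (ae_iff.1 (hK.ae_differentiableWithinAt_of_mem (μ := vol)))
  rintro z ⟨hz1, hz2⟩
  simp only [Set.mem_ofPred_eq, Classical.not_imp] at hz1 ⊢
  exact ⟨interior_subset hz2, fun hd =>
    hz1.2 (hd.differentiableAt (mem_interior_iff_mem_nhds.1 hz2))⟩

/-- The frontier of the convex effective domain is null, and a convex function is locally Lipschitz
in the interior of its domain. -/
theorem ae_mem_diffDomain (vol : Measure E) [vol.IsAddHaarMeasure] (ψ : E → ℝ≥0∞) :
    ∀ᵐ x ∂vol, polar ψ x ≠ ∞ → x ∈ diffDomain ψ := by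
  have h1 : ∀ᵐ x ∂vol, x ∉ frontier {z | polar ψ z ≠ ∞} :=
    measure_eq_zero_iff_ae_notMem.1 ((convex_polar_ne_top ψ).addHaar_frontier vol)
  have h2 := (convexOn_toReal_polar ψ).locallyLipschitzOn_interior.ae_differentiableAt_of_isOpen
    vol isOpen_interior
  filter_upwards [h1, h2] with x hx1 hx2 hx
  have hint : x ∈ interior {z | polar ψ z ≠ ∞} := by
    by_contra hcon
    exact hx1 ⟨subset_closure hx, hcon⟩
  exact ⟨hint, hx2 hint⟩

/-- Almost everywhere off `diffDomain` the polar is infinite and the density vanishes, so no mass is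
lost. This gives the equality of total masses behind the Euler-Lagrange equation. -/
theorem setLIntegral_diffDomain {vol W : Measure E} [vol.IsAddHaarMeasure] (hW : W ≪ vol)
    (ψ : E → ℝ≥0∞) : ∫⁻ x in diffDomain ψ, nexp (polar ψ x) ∂W = polarMass W ψ := by
  rw [← lintegral_indicator (measurableSet_diffDomain ψ), polarMass]
  refine lintegral_congr_ae ?_
  filter_upwards [hW.ae_le (ae_mem_diffDomain vol ψ)] with x hx
  by_cases hx' : x ∈ diffDomain ψ
  · rw [Set.indicator_of_mem hx']
  · have : polar ψ x = ∞ := by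
      by_contra hne
      exact hx' (hx hne)
    rw [Set.indicator_of_notMem hx', this, nexp_top]

end Differentiability

/-! ### Evenness of the polar and oddness of its gradient -/

section Symmetry

variable {E : Type*} [NormedAddCommGroup E] [InnerProductSpace ℝ E]

theorem neg_mem_diffDomain_iff {ψ : E → ℝ≥0∞} {x : E} : -x ∈ diffDomain ψ ↔ x ∈ diffDomain ψ := by
  have key : ∀ x, x ∈ diffDomain ψ → -x ∈ diffDomain ψ := by
    rintro x ⟨h1, h2⟩
    constructor
    · rw [mem_interior_iff_mem_nhds] at h1 ⊢
      have : Tendsto (fun z : E => -z) (𝓝 (-x)) (𝓝 x) := by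
        simpa using (continuous_neg (G := E)).tendsto (-x)
      filter_upwards [this h1] with z hz
      simpa [polar_neg] using hz
    · have h3 : DifferentiableAt ℝ ((fun z => (polar ψ z).toReal) ∘ fun z => -z) (-x) := by
        refine DifferentiableAt.comp (-x) ?_ (by fun_prop)
        rwa [neg_neg]
      simpa [Function.comp_def, polar_neg] using h3
  exact ⟨fun h => by simpa using key _ h, key x⟩

theorem gradient_toReal_polar_neg [CompleteSpace E] (ψ : E → ℝ≥0∞) (x : E) :
    gradient (fun z => (polar ψ z).toReal) (-x) = -gradient (fun z => (polar ψ z).toReal) x := by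
  have h : fderiv ℝ (fun z => (polar ψ z).toReal) x =
      -fderiv ℝ (fun z => (polar ψ z).toReal) (-x) := by
    have := (ContinuousLinearEquiv.neg ℝ (M := E)).comp_right_fderiv
      (f := fun z => (polar ψ z).toReal) (x := x)
    simp only [Function.comp_def, ContinuousLinearEquiv.neg_apply, polar_neg] at this
    rw [this]
    ext z
    simp
  rw [gradient, gradient, h, map_neg, neg_neg]

end Symmetry

/-! ### The Euler-Lagrange equation -/

section EulerLagrange

variable {E : Type*} [NormedAddCommGroup E] [InnerProductSpace ℝ E]
  [MeasurableSpace E] [BorelSpace E] [CompleteSpace E]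

theorem measurable_gradient_toReal_polar (ψ : E → ℝ≥0∞) :
    Measurable (gradient fun z => (polar ψ z).toReal) :=
  (LinearIsometryEquiv.continuous _).measurable.comp (measurable_fderiv ℝ _)

/-- The push-forward of `e^{-φ} dW` under `∇φ`, where `φ` is the polar of `ψ`. -/
noncomputable def gradientMeasure (W : Measure E) (ψ : E → ℝ≥0∞) : Measure E :=
  ((W.withDensity fun x => nexp (polar ψ x)).restrict (diffDomain ψ)).map
    (gradient fun z => (polar ψ z).toReal)

theorem lintegral_gradientMeasure (W : Measure E) (ψ : E → ℝ≥0∞) {g : E → ℝ≥0∞}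
    (hg : Measurable g) : ∫⁻ y, g y ∂(gradientMeasure W ψ) =
      ∫⁻ x in diffDomain ψ, nexp (polar ψ x) * g (gradient (fun z => (polar ψ z).toReal) x) ∂W := by
  have hgg : Measurable fun x => g (gradient (fun z => (polar ψ z).toReal) x) :=
    hg.comp (measurable_gradient_toReal_polar ψ)
  have hn : Measurable fun x => nexp (polar ψ x) := measurable_nexp.comp (measurable_polar ψ)
  rw [gradientMeasure, lintegral_map hg (measurable_gradient_toReal_polar ψ),
    restrict_withDensity (measurableSet_diffDomain ψ),
    lintegral_withDensity_eq_lintegral_mul _ hn hgg]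
  rfl

/-- The measure W and the polar are even and the gradient is odd, so the push-forward is even. -/
theorem lintegral_comp_neg_gradientMeasure {W : Measure E} (hW : W.map (fun x => -x) = W)
    (ψ : E → ℝ≥0∞) {g : E → ℝ≥0∞} (hg : Measurable g) :
    ∫⁻ y, g (-y) ∂(gradientMeasure W ψ) = ∫⁻ y, g y ∂(gradientMeasure W ψ) := by
  have hg' : Measurable fun y => g (-y) := hg.comp measurable_neg
  rw [lintegral_gradientMeasure W ψ hg', lintegral_gradientMeasure W ψ hg]
  have hmp : MeasurePreserving (fun x : E => -x) W W := ⟨measurable_neg, hW⟩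
  have hpre : (fun x : E => -x) ⁻¹' diffDomain ψ = diffDomain ψ :=
    Set.ext fun x => neg_mem_diffDomain_iff
  have hF : Measurable fun x =>
      nexp (polar ψ x) * g (gradient (fun z => (polar ψ z).toReal) x) :=
    (measurable_nexp.comp (measurable_polar ψ)).mul
      (hg.comp (measurable_gradient_toReal_polar ψ))
  have key := hmp.setLIntegral_comp_preimage (measurableSet_diffDomain ψ) hF
  rw [hpre] at key
  rw [← key]
  simp only [gradient_toReal_polar_neg, polar_neg]

variable [FiniteDimensional ℝ E]

-- An inequality of integrals for all nonnegative bounded continuous functions, together with equal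
-- finite total masses, forces the measures to coincide.
open scoped BoundedContinuousFunction in
theorem gradientMeasure_eq_smul {vol W μ : Measure E} [vol.IsAddHaarMeasure] [IsFiniteMeasure μ]
    (hμ : μ ≠ 0) (hμeven : μ.map (fun x => -x) = μ) (hW : W ≪ vol)
    (hWeven : W.map (fun x => -x) = W)
    {ψ : E → ℝ≥0∞} (hψm : Measurable ψ) (hψ0 : ψ 0 = 0) (hψint : ∫⁻ y, ψ y ∂μ ≠ ∞)
    (hJ : polarMass W ψ ≠ ∞)
    (hmax : ∀ ψ' : E → ℝ≥0∞, Measurable ψ' → dualValue W μ ψ' ≤ dualValue W μ ψ) :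
    gradientMeasure W ψ = (polarMass W ψ / μ Set.univ) • μ := by
  have h0 : μ Set.univ ≠ 0 := by simpa using hμ
  have h1 : μ Set.univ ≠ ∞ := measure_ne_top _ _
  set κ := polarMass W ψ / μ Set.univ with hκ
  have hκtop : κ ≠ ∞ := ENNReal.div_ne_top hJ h0
  have huniv : gradientMeasure W ψ Set.univ = polarMass W ψ := by
    have := lintegral_gradientMeasure W ψ (measurable_const (a := (1 : ℝ≥0∞)))
    simpa [setLIntegral_diffDomain hW] using this
  have : IsFiniteMeasure (gradientMeasure W ψ) := ⟨by rw [huniv]; exact hJ.lt_top⟩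
  have hle : ∀ g : E →ᵇ ℝ≥0, ∫⁻ y, g y ∂(gradientMeasure W ψ) ≤ ∫⁻ y, g y ∂(κ • μ) := by
    intro g
    have hgm : Measurable fun y => (g y : ℝ≥0∞) := g.continuous.measurable.coe_nnreal_ennreal
    have hgm' : Measurable fun y => (g (-y) : ℝ≥0∞) := hgm.comp measurable_neg
    obtain ⟨B, hB⟩ : ∃ B : ℝ≥0, ∀ y, g y ≤ B := by
      refine ⟨nndist g 0, fun y => ?_⟩
      have := BoundedContinuousFunction.nndist_coe_le_nndist (f := g) (g := 0) y
      simpa using this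
    -- The variation only sees even functions, so g is symmetrised; evenness of both measures
    -- doubles each side, and the factor 2 cancels.
    have hvar := setLIntegral_gradient_le (W := W) hμ hψm hψ0 hψint hJ hmax
      (g := fun y => g y + g (-y)) (by fun_prop) (fun y => by rw [neg_neg, add_comm])
      (B := B + B) (fun y => add_le_add (hB _) (hB _))
    rw [← lintegral_gradientMeasure W ψ (g := fun y => ((g y + g (-y) : ℝ≥0) : ℝ≥0∞))
      (by fun_prop)] at hvar
    simp only [ENNReal.coe_add] at hvar
    have hμneg : ∫⁻ y, (g (-y) : ℝ≥0∞) ∂μ = ∫⁻ y, (g y : ℝ≥0∞) ∂μ := by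
      conv_rhs => rw [← hμeven, lintegral_map hgm measurable_neg]
    rw [lintegral_add_left hgm, lintegral_comp_neg_gradientMeasure hWeven ψ hgm,
      lintegral_add_left hgm, hμneg, ← two_mul, ← two_mul, mul_div_assoc, mul_left_comm,
      ENNReal.mul_le_mul_iff_right two_ne_zero ENNReal.ofNat_ne_top] at hvar
    rw [lintegral_smul_measure, smul_eq_mul, hκ]
    refine hvar.trans_eq ?_
    simp only [div_eq_mul_inv]
    ring
  have hfin : ∀ (g : E →ᵇ ℝ≥0) (ν : Measure E) [IsFiniteMeasure ν], ∫⁻ y, g y ∂ν ≠ ∞ :=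
    fun g ν _ => (BoundedContinuousFunction.lintegral_lt_top_of_nnreal ν g).ne
  refine ext_of_forall_lintegral_eq_of_IsFiniteMeasure fun g => (hle g).antisymm ?_
  set B : ℝ≥0 := nndist g 0 with hBdef
  have hB : ∀ y, g y ≤ B := fun y => by
    have := BoundedContinuousFunction.nndist_coe_le_nndist (f := g) (g := 0) y
    simpa using this
  -- The inequality for B - g gives the reverse inequality for g, since constants have equal
  -- integrals.
  set g' : E →ᵇ ℝ≥0 := BoundedContinuousFunction.const E B - g with hg'
  have hsum : ∀ y, (g y : ℝ≥0∞) + g' y = B := fun y => by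
    rw [← ENNReal.coe_add, ENNReal.coe_inj]
    simp [hg', hB y]
  have hgm : Measurable fun y => (g y : ℝ≥0∞) := g.continuous.measurable.coe_nnreal_ennreal
  have htot : ∫⁻ y, g y ∂(gradientMeasure W ψ) + ∫⁻ y, g' y ∂(gradientMeasure W ψ) =
      ∫⁻ y, g y ∂(κ • μ) + ∫⁻ y, g' y ∂(κ • μ) := by
    rw [← lintegral_add_left hgm, ← lintegral_add_left hgm]
    simp_rw [hsum]
    rw [lintegral_const, lintegral_const, huniv, Measure.smul_apply, smul_eq_mul, hκ,
      ENNReal.div_mul_cancel h0 h1]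
  have h2 := hle g'
  rw [← ENNReal.add_le_add_iff_right (hfin g' (gradientMeasure W ψ)), htot]
  exact add_le_add le_rfl h2

end EulerLagrange

end OrliczMinkowski

namespace OrliczMinkowski

/-! ### Verification of the hypotheses for weights and measures -/

section Bounds

variable {E : Type*} [NormedAddCommGroup E] [InnerProductSpace ℝ E] [FiniteDimensional ℝ E]
  [MeasurableSpace E] [BorelSpace E]

theorem integrable_exp_neg_mul_norm (vol : Measure E) [vol.IsAddHaarMeasure] {a : ℝ} (ha : 0 < a) :
    Integrable (fun x : E => Real.exp (-(a * ‖x‖))) vol := by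
  -- The exponent exceeds the dimension, so (1 + ‖x‖)^{-N} is integrable and dominates the
  -- exponential.
  set N := Module.finrank ℝ E + 1 with hN
  have h1 : Integrable (fun x : E => (1 + ‖x‖) ^ (-(N : ℝ))) vol :=
    integrable_one_add_norm (by simp [hN])
  refine (h1.const_mul (Real.exp a * N.factorial / a ^ N)).mono'
    (by fun_prop) (Eventually.of_forall fun x => ?_)
  have hs : 0 < 1 + ‖x‖ := by positivity
  have h2 := Real.pow_div_factorial_le_exp (a * (1 + ‖x‖)) (by positivity) N
  rw [Real.norm_of_nonneg (Real.exp_pos _).le, Real.rpow_neg hs.le, Real.rpow_natCast]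
  have h3 : Real.exp (-(a * ‖x‖)) = Real.exp a / Real.exp (a * (1 + ‖x‖)) := by
    rw [← Real.exp_sub]
    congr 1
    ring
  rw [h3, div_le_iff₀ (Real.exp_pos _)]
  have hfac : (0 : ℝ) < N.factorial := by exact_mod_cast N.factorial_pos
  calc Real.exp a = Real.exp a * N.factorial / a ^ N * ((1 + ‖x‖) ^ N)⁻¹ *
        ((a * (1 + ‖x‖)) ^ N / N.factorial) := by
        rw [mul_pow]
        field_simp
    _ ≤ _ := by gcongr

/-- The function v ↦ ∫ |⟨v,y⟩| dμ attains its minimum on the unit sphere. A zero minimum would put μ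
on the hyperplane orthogonal to the minimiser; homogeneity does the rest. -/
theorem exists_mul_norm_le_lintegral_inner {μ : Measure E} [IsFiniteMeasure μ] (hμ : μ ≠ 0)
    (hμsub : ∀ V : Submodule ℝ E, V ≠ ⊤ → μ (V : Set E)ᶜ ≠ 0)
    (hμmoment : Integrable (fun x => ‖x‖) μ) :
    ∃ a : ℝ, 0 < a ∧
      ∀ x : E, ENNReal.ofReal (a * ‖x‖) * μ Set.univ ≤ ∫⁻ y, ENNReal.ofReal |⟪x, y⟫| ∂μ := by
  have hμr : 0 < μ.real Set.univ := by
    rw [measureReal_def, ENNReal.toReal_pos_iff]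
    exact ⟨Measure.measure_univ_pos.2 hμ, measure_lt_top _ _⟩
  have hint : ∀ v : E, Integrable (fun y => |⟪v, y⟫|) μ := fun v =>
    (hμmoment.const_mul ‖v‖).mono' (by fun_prop)
      (Eventually.of_forall fun y => by
        rw [Real.norm_of_nonneg (abs_nonneg _)]
        exact abs_real_inner_le_norm v y)
  rcases subsingleton_or_nontrivial E with hE | hE
  · exact ⟨1, one_pos, fun x => by simp [Subsingleton.elim x 0]⟩
  have hcont : ContinuousOn (fun v : E => ∫ y, |⟪v, y⟫| ∂μ) (Metric.sphere 0 1) := by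
    refine continuousOn_of_dominated (bound := fun y => ‖y‖) (fun v _ => by fun_prop)
      (fun v hv => Eventually.of_forall fun y => ?_) hμmoment
      (Eventually.of_forall fun y => by fun_prop)
    rw [Real.norm_of_nonneg (abs_nonneg _)]
    have hv1 : ‖v‖ = 1 := by simpa using hv
    simpa [hv1] using abs_real_inner_le_norm v y
  obtain ⟨v, hv, hmin⟩ := (isCompact_sphere (0 : E) 1).exists_isMinOn
    (NormedSpace.sphere_nonempty.2 zero_le_one) hcont
  have hv0 : v ≠ 0 := by
    rintro rfl
    simp at hv
  have hpos : 0 < ∫ y, |⟪v, y⟫| ∂μ := by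
    refine (integral_nonneg fun y => abs_nonneg _).lt_of_ne' fun h0 => ?_
    rw [integral_eq_zero_iff_of_nonneg (fun y => abs_nonneg _) (hint v)] at h0
    refine hμsub ((ℝ ∙ v)ᗮ) (fun htop => hv0 ?_) ?_
    · have : v ∈ ((ℝ ∙ v)ᗮ : Submodule ℝ E) := htop ▸ Submodule.mem_top
      rwa [Submodule.mem_orthogonal_singleton_iff_inner_left, inner_self_eq_zero] at this
    · rw [← mem_ae_iff]
      filter_upwards [h0] with y hy
      simpa [Submodule.mem_orthogonal_singleton_iff_inner_right] using hy
  refine ⟨(∫ y, |⟪v, y⟫| ∂μ) / μ.real Set.univ, by positivity, fun x => ?_⟩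
  rw [← ofReal_integral_eq_lintegral_ofReal (hint x) (Eventually.of_forall fun y => abs_nonneg _),
    ← ofReal_measureReal (measure_ne_top μ Set.univ), ← ENNReal.ofReal_mul (by positivity)]
  refine ENNReal.ofReal_le_ofReal ?_
  rcases eq_or_ne x 0 with rfl | hx
  · simp
  have hxn : 0 < ‖x‖ := norm_pos_iff.2 hx
  have h1 : ∫ y, |⟪v, y⟫| ∂μ ≤ ∫ y, |⟪‖x‖⁻¹ • x, y⟫| ∂μ :=
    hmin (by simp [norm_smul, hxn.ne'])
  simp only [real_inner_smul_left, abs_mul, abs_inv, abs_norm] at h1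
  rw [integral_const_mul, ← div_eq_inv_mul, le_div_iff₀ hxn] at h1
  calc _ = (∫ y, |⟪v, y⟫| ∂μ) * ‖x‖ := by field_simp
    _ ≤ _ := h1

end Bounds

/-! ### The measure with density ω -/

section Weight

variable {n : ℕ} {ω : EuclideanSpace ℝ (Fin n) → ℝ}

/-- The measure `ω dx`. -/
noncomputable def weightMeasure (ω : EuclideanSpace ℝ (Fin n) → ℝ) :
    Measure (EuclideanSpace ℝ (Fin n)) :=
  volume.withDensity fun x => ENNReal.ofReal (ω x)

theorem IsWeight.aemeasurable (hω : IsWeight ω) :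
    AEMeasurable (fun x => ENNReal.ofReal (ω x)) volume :=
  hω.locallyIntegrable.aestronglyMeasurable.aemeasurable.ennreal_ofReal

theorem weightMeasure_absolutelyContinuous : weightMeasure ω ≪ volume :=
  withDensity_absolutelyContinuous _ _

theorem IsWeight.volume_absolutelyContinuous (hn : 1 ≤ n) (hω : IsWeight ω) :
    volume ≪ weightMeasure ω := by
  have : Nonempty (Fin n) := ⟨⟨0, hn⟩⟩
  refine withDensity_absolutelyContinuous' hω.aemeasurable ?_
  have h0 : ∀ᵐ x : EuclideanSpace ℝ (Fin n), x ∉ ({0} : Set _) :=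
    measure_eq_zero_iff_ae_notMem.1 (measure_singleton 0)
  filter_upwards [h0] with x hx
  simpa using hω.pos x hx

theorem map_neg_weightMeasure (heven : ∀ x, ω (-x) = ω x) :
    (weightMeasure ω).map (fun x => -x) = weightMeasure ω := by
  ext A hA
  rw [Measure.map_apply measurable_neg hA, weightMeasure, withDensity_apply _ hA,
    withDensity_apply _ (measurable_neg hA)]
  have hmp : MeasurePreserving (fun x : EuclideanSpace ℝ (Fin n) => -x) volume volume :=
    Measure.measurePreserving_neg volume
  have key := hmp.setLIntegral_comp_preimage_emb (MeasurableEquiv.neg _).measurableEmbedding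
    (fun x => ENNReal.ofReal (ω x)) A
  simpa only [heven] using key

/-- Outside a large ball the growth condition at infinity gives ω ≤ exp(a‖x‖/2), leaving the
integrable exp(-a‖x‖/2); inside, ω itself is integrable. -/
theorem IsWeight.lintegral_nexp_ne_top (hω : IsWeight ω) {a : ℝ} (ha : 0 < a) :
    ∫⁻ x, nexp (ENNReal.ofReal (a * ‖x‖)) ∂(weightMeasure ω) ≠ ∞ := by
  have hev : ∀ᶠ x in Bornology.cobounded (EuclideanSpace ℝ (Fin n)),
      ((Real.log (ω x) / ‖x‖ : ℝ) : EReal) < ((a / 2 : ℝ) : EReal) :=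
    eventually_lt_of_limsup_lt (hω.limsup_infty.trans_lt (by exact_mod_cast half_pos ha))
  obtain ⟨R, -, hR⟩ := (hasBasis_cobounded_norm.eventually_iff).1 hev
  have hm : Measurable fun x : EuclideanSpace ℝ (Fin n) => nexp (ENNReal.ofReal (a * ‖x‖)) :=
    measurable_nexp.comp (by fun_prop)
  rw [weightMeasure, lintegral_withDensity_eq_lintegral_mul₀ hω.aemeasurable hm.aemeasurable]
  set S : Set (EuclideanSpace ℝ (Fin n)) := Metric.closedBall 0 (max R 1) with hS
  have hSi : ∫⁻ x in S, ENNReal.ofReal (ω x) ≠ ∞ :=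
    ((hω.locallyIntegrable.integrableOn_isCompact
      (isCompact_closedBall 0 (max R 1))).lintegral_lt_top).ne
  have hEi : ∫⁻ x : EuclideanSpace ℝ (Fin n), ENNReal.ofReal (Real.exp (-(a / 2 * ‖x‖))) ≠ ∞ :=
    (integrable_exp_neg_mul_norm volume (half_pos ha)).lintegral_lt_top.ne
  refine ne_top_of_le_ne_top (ENNReal.add_ne_top.2 ⟨hSi, hEi⟩) ?_
  rw [← lintegral_indicator measurableSet_closedBall, ← lintegral_add_right _ (by fun_prop)]
  refine lintegral_mono fun x => ?_
  simp only [Pi.mul_apply]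
  by_cases hx : x ∈ S
  · rw [Set.indicator_of_mem hx]
    exact (mul_le_of_le_one_right' (nexp_le_one _)).trans le_self_add
  · rw [Set.indicator_of_notMem hx, zero_add]
    have hx' : max R 1 < ‖x‖ := by simpa [hS] using hx
    have hxpos : 0 < ‖x‖ := zero_lt_one.trans ((le_max_right R 1).trans_lt hx')
    have h1 : Real.log (ω x) / ‖x‖ < a / 2 := by
      exact EReal.coe_lt_coe_iff.1 (hR (show R ≤ ‖x‖ from (le_max_left R 1).trans hx'.le))
    rw [div_lt_iff₀ hxpos] at h1
    have hωx := hω.pos x (norm_pos_iff.1 hxpos)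
    have h2 : ω x ≤ Real.exp (a / 2 * ‖x‖) := (Real.log_le_iff_le_exp hωx).1 h1.le
    rw [nexp_ofReal (by positivity), ← ENNReal.ofReal_mul hωx.le]
    refine ENNReal.ofReal_le_ofReal ?_
    calc ω x * Real.exp (-(a * ‖x‖)) ≤ Real.exp (a / 2 * ‖x‖) * Real.exp (-(a * ‖x‖)) := by gcongr
      _ = _ := by rw [← Real.exp_add]; congr 1; ring

end Weight

end OrliczMinkowski

namespace OrliczMinkowski

/-! ### The log-concave function attached to a maximiser -/

section LogConcave

variable {n : ℕ} {ψ : EuclideanSpace ℝ (Fin n) → ℝ≥0∞} {κ : ℝ}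

/-- The log-concave function `κ e^{-φ}`, where `φ` is the polar of `ψ`. -/
noncomputable def polarDensity (κ : ℝ) (ψ : EuclideanSpace ℝ (Fin n) → ℝ≥0∞)
    (x : EuclideanSpace ℝ (Fin n)) : ℝ :=
  κ * (nexp (polar ψ x)).toReal

theorem isLC_polarDensity (hκ : 0 < κ) (hint : ∫⁻ x, nexp (polar ψ x) ≠ ∞)
    (hpos : ∫⁻ x, nexp (polar ψ x) ≠ 0) : IsLC (polarDensity κ ψ) where
  nonneg x := mul_nonneg hκ.le ENNReal.toReal_nonneg
  logConcave x y a b ha hb hab := by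
    simp only [polarDensity]
    rw [Real.mul_rpow hκ.le ENNReal.toReal_nonneg, Real.mul_rpow hκ.le ENNReal.toReal_nonneg,
      mul_mul_mul_comm, ← Real.rpow_add hκ, hab, Real.rpow_one]
    gcongr
    by_cases hx : polar ψ x = ∞
    · simp [hx, Real.zero_rpow ha.ne']
    by_cases hy : polar ψ y = ∞
    · simp [hy, Real.zero_rpow hb.ne']
    have hxy := convex_polar_ne_top ψ (show x ∈ {z | polar ψ z ≠ ∞} from hx) hy ha.le hb.le hab
    have h := (convexOn_toReal_polar ψ).2 (show x ∈ {z | polar ψ z ≠ ∞} from hx) hy ha.le hb.le hab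
    rw [toReal_nexp_of_ne_top hx, toReal_nexp_of_ne_top hy, toReal_nexp_of_ne_top hxy,
      ← Real.exp_mul, ← Real.exp_mul, ← Real.exp_add, Real.exp_le_exp]
    simp only [smul_eq_mul] at h
    linarith
  -- A continuous decreasing function of a lower semicontinuous one.
  upperSemicontinuous := by
    have hc : Continuous fun a : ℝ≥0∞ => κ * (nexp a).toReal :=
      continuous_const.mul (continuous_iff_continuousAt.2 fun a =>
        (ENNReal.tendsto_toReal (nexp_ne_top a)).comp continuous_nexp.continuousAt)
    have ha : Antitone fun a : ℝ≥0∞ => κ * (nexp a).toReal := fun a b hab =>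
      mul_le_mul_of_nonneg_left (ENNReal.toReal_mono (nexp_ne_top _) (nexp_antitone hab)) hκ.le
    exact hc.comp_lowerSemicontinuous_antitone (lowerSemicontinuous_polar ψ) ha
  integrable := (integrable_toReal_of_lintegral_ne_top
    (measurable_nexp.comp (measurable_polar ψ)).aemeasurable hint).const_mul κ
  integral_pos := by
    simp only [polarDensity]
    have hn : Measurable fun x => nexp (polar ψ x) := measurable_nexp.comp (measurable_polar ψ)
    rw [integral_const_mul, integral_toReal hn.aemeasurable
      (Eventually.of_forall fun x => (nexp_ne_top _).lt_top)]
    exact mul_pos hκ (ENNReal.toReal_pos hpos hint)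

theorem setOf_polarDensity_pos (hκ : 0 < κ) :
    {x | 0 < polarDensity κ ψ x} = {x | polar ψ x ≠ ∞} := by
  ext x
  simp [polarDensity, hκ, mul_pos_iff_of_pos_left, toReal_nexp_pos_iff]

theorem potential_polarDensity (hκ : 0 < κ) {x : EuclideanSpace ℝ (Fin n)}
    (hx : polar ψ x ≠ ∞) :
    potential (polarDensity κ ψ) x = (polar ψ x).toReal + -Real.log κ := by
  rw [potential, polarDensity, Real.log_mul hκ.ne' (toReal_nexp_pos_iff.2 hx).ne', neg_add,
    neg_log_toReal_nexp, add_comm]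

theorem potential_polarDensity_eventuallyEq (hκ : 0 < κ) {x : EuclideanSpace ℝ (Fin n)}
    (hx : x ∈ interior {z | polar ψ z ≠ ∞}) :
    potential (polarDensity κ ψ) =ᶠ[𝓝 x] fun z => (polar ψ z).toReal + -Real.log κ := by
  filter_upwards [isOpen_interior.mem_nhds hx] with z hz
  exact potential_polarDensity hκ (interior_subset hz)

theorem gradDomain_polarDensity (hκ : 0 < κ) : gradDomain (polarDensity κ ψ) = diffDomain ψ := by
  ext x
  simp only [gradDomain, diffDomain, setOf_polarDensity_pos hκ, Set.mem_ofPred_eq]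
  refine and_congr_right fun hx => ?_
  rw [(potential_polarDensity_eventuallyEq hκ hx).differentiableAt_iff, differentiableAt_add_const_iff]

theorem gradient_potential_polarDensity (hκ : 0 < κ) {x : EuclideanSpace ℝ (Fin n)}
    (hx : x ∈ interior {z | polar ψ z ≠ ∞}) :
    gradient (potential (polarDensity κ ψ)) x = gradient (fun z => (polar ψ z).toReal) x := by
  rw [gradient, gradient, (potential_polarDensity_eventuallyEq hκ hx).fderiv_eq, fderiv_add_const]

/-- The factor κ shifts the potential by a constant, so it leaves the gradient unchanged and only
scales the density. -/
theorem curvatureMeasure_polarDensity {ω : EuclideanSpace ℝ (Fin n) → ℝ} (hω : IsWeight ω)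
    (hκ : 0 < κ) : curvatureMeasure ω (polarDensity κ ψ) =
      ENNReal.ofReal κ • gradientMeasure (weightMeasure ω) ψ := by
  ext B hB
  have hset : {x | x ∈ gradDomain (polarDensity κ ψ) ∧
      gradient (potential (polarDensity κ ψ)) x ∈ B} =
      gradient (fun z => (polar ψ z).toReal) ⁻¹' B ∩ diffDomain ψ := by
    ext x
    rw [gradDomain_polarDensity hκ]
    simp only [Set.mem_ofPred_eq, Set.mem_inter_iff, Set.mem_preimage]
    rw [and_comm]
    refine and_congr_left fun hx => ?_
    rw [gradient_potential_polarDensity hκ hx.1]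
  have hS : MeasurableSet (gradient (fun z => (polar ψ z).toReal) ⁻¹' B ∩ diffDomain ψ) :=
    (measurable_gradient_toReal_polar ψ hB).inter (measurableSet_diffDomain ψ)
  have hn : Measurable fun x => nexp (polar ψ x) := measurable_nexp.comp (measurable_polar ψ)
  rw [curvatureMeasure_apply ω _ hB, hset, Measure.smul_apply, gradientMeasure,
    Measure.map_apply (measurable_gradient_toReal_polar ψ) hB,
    Measure.restrict_apply (measurable_gradient_toReal_polar ψ hB), withDensity_apply _ hS,
    weightMeasure, restrict_withDensity hS,
    lintegral_withDensity_eq_lintegral_mul₀ hω.aemeasurable.restrict hn.aemeasurable,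
    smul_eq_mul, ← lintegral_const_mul' _ _ ENNReal.ofReal_ne_top]
  refine lintegral_congr fun x => ?_
  simp only [polarDensity, Pi.mul_apply]
  rw [ENNReal.ofReal_mul (mul_nonneg hκ.le ENNReal.toReal_nonneg), ENNReal.ofReal_mul hκ.le,
    ENNReal.ofReal_toReal (nexp_ne_top _), mul_assoc, mul_comm (nexp _)]

end LogConcave

end OrliczMinkowski

open OrliczMinkowski in
/-- Solution of the even Euclidean dual Orlicz-Minkowski problem, by maximising
`∫ e^{-φ} ω dx · exp (-∫ ψ dμ / |μ|)` over potentials `ψ ≥ 0` with polar `φ`. Since the lower bound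
`φ ≥ a ‖x‖ - ∫ ψ dμ / |μ|` already makes `∫ ψ dμ` bounded along a maximising sequence, the
growth condition `hlim` is not needed. -/
theorem theorem5p9 {n : ℕ} (hn : 1 ≤ n)
    (ω : EuclideanSpace ℝ (Fin n) → ℝ) (hω : OrliczMinkowski.IsWeight ω)
    (hωeven : ∀ x, ω (-x) = ω x)
    (μ : Measure (EuclideanSpace ℝ (Fin n))) [IsFiniteMeasure μ] (hμ0 : μ ≠ 0)
    (hμeven : μ.map (fun x => -x) = μ)
    (hμsub : ∀ W : Submodule ℝ (EuclideanSpace ℝ (Fin n)), W ≠ ⊤ →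
      μ (W : Set (EuclideanSpace ℝ (Fin n)))ᶜ ≠ 0)
    (hμmoment : Integrable (fun x => ‖x‖) μ)
    (hlim : liminf (fun t : ℝ => OrliczMinkowski.orliczF ω t *
      ENNReal.ofReal (Real.exp (-(OrliczMinkowski.zeta μ / (2 * μ.real Set.univ * t)))))
      (𝓝[>] 0) = 0) :
    ∃ f : EuclideanSpace ℝ (Fin n) → ℝ,
      OrliczMinkowski.IsLC f ∧ μ = OrliczMinkowski.curvatureMeasure ω f := by
  have h0 : μ Set.univ ≠ 0 := by simpa using hμ0
  have h1 : μ Set.univ ≠ ∞ := measure_ne_top _ _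
  have hW := weightMeasure_absolutelyContinuous (ω := ω)
  have hW' := hω.volume_absolutelyContinuous hn
  obtain ⟨a, ha0, ha⟩ := exists_mul_norm_le_lintegral_inner hμ0 hμsub hμmoment
  have hball : weightMeasure ω (Metric.closedBall 0 1) ≠ 0 := fun h =>
    (Metric.measure_closedBall_pos volume (0 : EuclideanSpace ℝ (Fin n)) one_pos).ne' (hW' h)
  obtain ⟨ψ, hψm, hψ0, hψint, hJ0, hJ, hmax⟩ := exists_maximizer hμ0 hW hball
    hμmoment.lintegral_lt_top.ne ha (hω.lintegral_nexp_ne_top ha0)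
  have hEL := gradientMeasure_eq_smul hμ0 hμeven hW (map_neg_weightMeasure hωeven) hψm hψ0
    hψint hJ hmax
  set J := polarMass (weightMeasure ω) ψ with hJdef
  -- The Euler-Lagrange equation gives (J/|μ|) μ, so the density is scaled by |μ|/J.
  have hκ0 : μ Set.univ / J ≠ 0 := ENNReal.div_ne_zero.2 ⟨h0, hJ⟩
  have hκtop : μ Set.univ / J ≠ ∞ := ENNReal.div_ne_top h1 hJ0
  have hκ : 0 < (μ Set.univ / J).toReal := ENNReal.toReal_pos hκ0 hκtop
  have hn : Measurable fun x => nexp (polar ψ x) := measurable_nexp.comp (measurable_polar ψ)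
  refine ⟨polarDensity (μ Set.univ / J).toReal ψ, isLC_polarDensity hκ ?_ ?_, ?_⟩
  · have hM : nexp ((∫⁻ y, ψ y ∂μ) / μ Set.univ) ≠ 0 := by
      rw [Ne, nexp_eq_zero_iff]
      exact ENNReal.div_ne_top hψint h0
    -- Lebesgue integrability of e^{-φ}, as opposed to integrability against ω, also follows from
    -- the coercivity bound φ + m(ψ) ≥ a‖x‖.
    have hle : (∫⁻ x, nexp (polar ψ x)) * nexp ((∫⁻ y, ψ y ∂μ) / μ Set.univ) ≤
        ∫⁻ x : EuclideanSpace ℝ (Fin n), ENNReal.ofReal (Real.exp (-(a * ‖x‖))) := by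
      rw [← lintegral_mul_const _ hn]
      refine lintegral_mono fun x => ?_
      rw [← nexp_add, ← nexp_ofReal (by positivity)]
      exact nexp_antitone (ofReal_mul_norm_le_polar_add hμ0 ha ψ x)
    intro htop
    rw [htop, ENNReal.top_mul hM] at hle
    exact absurd (integrable_exp_neg_mul_norm volume ha0).lintegral_lt_top (not_lt.2 hle)
  · intro hz
    refine hJ0 ?_
    rw [lintegral_eq_zero_iff hn] at hz
    exact (lintegral_eq_zero_iff hn).2 (hW.ae_le hz)
  · rw [curvatureMeasure_polarDensity hω hκ, hEL, ENNReal.ofReal_toReal hκtop, smul_smul,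
      ← mul_div_assoc, ENNReal.div_mul_cancel hJ0 hJ, ENNReal.div_self h0 h1, one_smul]
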